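/- **Local Dealternation Lemma.** *Definitions.* Let $\mathbb F$ be a finite field. A subspace arrangement is a finite (indexed) family $\mathcal V=\{V_1,\dots,V_n\}$ of linear subspaces of $\mathbb F^d$; for a subfamily $\mathcal A$ write $\langle\mathcal A\rangle$ for the sum of its members. A *binary tree* is a finite rooted tree in which each node has $0$ or $2$ children and which has at least two leaves. A *rooted rank decomposition* $\mathcal T=(T,\lambda)$ of $\mathcal V$ is a binary tree $T$ with a bijection $\lambda$ from $\mathcal V$ to the leaves of $T$. For a node $v$ of $T$, $\mathcal L(\mathcal T)[v]\subseteq\mathcal V$ is the set of members mapped to leaves that are descendants of $v$ (every node is a descendant of itself). The width of $\mathcal T$ is the maximum over the non-root nodes $v$ of $\dim\big(\langle\mathcal L(\mathcal T)[v]\rangle\cap\langle\mathcal V\setminus\mathcal L(\mathcal T)[v]\rangle\big)$; $\mathcal T$ has optimum width if no rooted rank decomposition of $\mathcal V$ has smaller width. A *tree factor* of $\mathcal T$ is a set $\mathcal L(\mathcal T)[v]$; a *context factor* is a difference of two tree factors that is not a tree factor; a *factor* is a tree factor or a context factor. Let $\mathcal T^b=(T^b,\lambda^b)$ and $\mathcal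 T=(T,\lambda)$ be rooted rank decompositions of $\mathcal V$, let $x\in V(T^b)$ and $\mathcal V_x=\mathcal L(\mathcal T^b)[x]$. An *$x$-factor* of $\mathcal T$ is a factor of $\mathcal T$ that is contained in $\mathcal V_x$. A node $v$ of $T$ is *$x$-full* if $\mathcal L(\mathcal T)[v]\subseteq\mathcal V_x$, *$x$-empty* if $\mathcal L(\mathcal T)[v]\cap\mathcal V_x=\emptyset$, and *$x$-mixed* otherwise. The *$x$-mixed skeleton* of $\mathcal T$ is the (possibly empty) rooted tree whose vertices are the nodes $v$ of $T$ with two children such that either one child is $x$-empty and the other $x$-full, or both children are $x$-mixed; two distinct vertices are adjacent if the path between them in $T$ has no internal node that is a vertex of the skeleton; its root is the vertex that is an ancestor in $T$ of all of its vertices. *Statement.* For every function $g\colon\mathbb N\to\mathbb N$ there is a function $f\colon\mathbb N\to\mathbb N$ such that the following holds. Let $\mathcal V$ be a subspace arrangement over $\mathbb F$, let $\mathcal T^b$ be a rooted rank decomposition of $\mathcal V$ of width $\ell\ge 0$, and let $\mathcal T$ be a rooted rank decomposition of $\mathcal V$ of optimum width. Let $x\in V(T^b)$ be such that the $x$-mixed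 skeleton of $\mathcal T$ has at most $g(\ell)$ nodes. Then there is a rooted rank decomposition $\mathcal T'$ of $\mathcal V$ of optimum width, on the same set of nodes as $\mathcal T$, such that 1. $\mathcal L(\mathcal T^b)[x]$ is a disjoint union of at most $f(\ell)$ $x$-factors of $\mathcal T'$; 2. for every $y\in V(T^b)$, the $y$-mixed skeletons of $\mathcal T$ and $\mathcal T'$ are equal; 3. for every $y\in V(T^b)$ that is not a strict ancestor of $x$, every $y$-factor of $\mathcal T$ is also a $y$-factor of $\mathcal T'$. -/

import Mathlib

/-- A rooted tree on the node set `N`, given by its root and its parent map. The root is its own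
parent by convention, and every node reaches the root by iterating `parent`. -/
structure RootedTreeOn (N : Type*) where
  root : N
  parent : N → N
  parent_root : parent root = root
  reaches_root : ∀ v, ∃ k : ℕ, parent^[k] v = root

namespace RootedTreeOn

variable {N : Type*} (T : RootedTreeOn N)

/-- The set of children of `v`. -/
def children (v : N) : Set N := {c | c ≠ T.root ∧ T.parent c = v}

/-- A leaf is a node without children. -/
def IsLeaf (v : N) : Prop := T.children v = ∅

/-- `T.Le u v`, i.e. `u ≤ v`: `u` is a (not necessarily strict) descendant of `v`. -/
def Le (u v : N) : Prop := ∃ k : ℕ, T.parent^[k] u = v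

/-- `T.Lt u v`, i.e. `u < v`: `u` is a strict descendant of `v`. -/
def Lt (u v : N) : Prop := T.Le u v ∧ u ≠ v

/-- The underlying undirected tree: the edges join the non-root nodes to their parents. -/
def graph : SimpleGraph N := SimpleGraph.fromRel fun u v => T.parent u = v

end RootedTreeOn

/-- A binary tree: a rooted tree in which every node has `0` or `2` children and which has at
least two leaves. (It is used for finite node sets `N` only.) -/
structure BinaryTreeOn (N : Type*) extends RootedTreeOn N where
  leaf_or_two_children : ∀ v, toRootedTreeOn.IsLeaf v ∨ (toRootedTreeOn.children v).ncard = 2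
  two_leaves : {v | toRootedTreeOn.IsLeaf v}.Nontrivial

/-- A rooted rank decomposition, with node set `N`, of the subspace arrangement `V`: a binary tree
with a bijection from the members of the (indexed) family `V` to the leaves. -/
structure RootedRankDecomposition {F : Type*} [Field F] {d : ℕ} {ι : Type*}
    (V : ι → Submodule F (Fin d → F)) (N : Type*) where
  tree : BinaryTreeOn N
  leaf : ι ≃ {v : N // tree.IsLeaf v}

/-- The data of a (possibly empty) rooted tree whose vertices are nodes of another tree:
its vertices, its edges, and its root (`IsRoot` holds for no vertex if the tree is empty). -/
structure Skeleton (N : Type*) where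
  verts : Set N
  Adj : N → N → Prop
  IsRoot : N → Prop

namespace RootedRankDecomposition

variable {F : Type*} [Field F] {d : ℕ} {ι : Type*} {V : ι → Submodule F (Fin d → F)}
  {N M : Type*}

/-- `T.leaves v` is `L(T)[v]`: the (indices of) members of `V` mapped to a leaf below `v`. -/
def leaves (T : RootedRankDecomposition V N) (v : N) : Set ι := {i | T.tree.Le (T.leaf i) v}

/-- The boundary space `B_v`: the intersection of the sum of the subspaces below `v` with the sum
of the remaining ones. At the root this is the zero space. -/
def boundary (T : RootedRankDecomposition V N) (v : N) : Submodule F (Fin d → F) :=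
  (⨆ i ∈ T.leaves v, V i) ⊓ (⨆ i ∈ (T.leaves v)ᶜ, V i)

/-- The width: the maximum of `dim B_v` over the non-root nodes `v`, i.e. over the edges. -/
noncomputable def width [Fintype N] (T : RootedRankDecomposition V N) : ℕ :=
  open Classical in
  (Finset.univ.filter (· ≠ T.tree.root)).sup fun v => Module.finrank F (T.boundary v)

/-- `T` has optimum width: no rooted rank decomposition of `V` has smaller width. (Every finite
tree is isomorphic to one with node set `Fin m`.) -/
def IsOptimum [Fintype N] (T : RootedRankDecomposition V N) : Prop :=
  ∀ (m : ℕ) (S : RootedRankDecomposition V (Fin m)), T.width ≤ S.width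

/-- A tree factor of `T` is a set `L(T)[t]` for a node `t`. -/
def IsTreeFactor (T : RootedRankDecomposition V N) (A : Set ι) : Prop := ∃ t, A = T.leaves t

/-- A context factor of `T` is a difference of two tree factors that is not a tree factor. -/
def IsContextFactor (T : RootedRankDecomposition V N) (A : Set ι) : Prop :=
  ¬ T.IsTreeFactor A ∧ ∃ A₁ A₂, T.IsTreeFactor A₁ ∧ T.IsTreeFactor A₂ ∧ A = A₁ \ A₂

/-- A factor of `T` is a tree factor or a context factor of `T`. -/
def IsFactor (T : RootedRankDecomposition V N) (A : Set ι) : Prop :=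
  T.IsTreeFactor A ∨ T.IsContextFactor A

/-- An `x`-factor of `T`, for a node `x` of `Tb`: a factor of `T` contained in `L(Tb)[x]`. -/
def IsNodeFactor (Tb : RootedRankDecomposition V M) (x : M) (T : RootedRankDecomposition V N)
    (A : Set ι) : Prop :=
  T.IsFactor A ∧ A ⊆ Tb.leaves x

/-- The node `v` of `T` is `x`-full, for a node `x` of `Tb`. -/
def IsFull (Tb : RootedRankDecomposition V M) (x : M) (T : RootedRankDecomposition V N)
    (v : N) : Prop :=
  T.leaves v ⊆ Tb.leaves x

/-- The node `v` of `T` is `x`-empty, for a node `x` of `Tb`. -/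
def IsEmptyAt (Tb : RootedRankDecomposition V M) (x : M) (T : RootedRankDecomposition V N)
    (v : N) : Prop :=
  T.leaves v ∩ Tb.leaves x = ∅

/-- The node `v` of `T` is `x`-mixed, for a node `x` of `Tb`. -/
def IsMixed (Tb : RootedRankDecomposition V M) (x : M) (T : RootedRankDecomposition V N)
    (v : N) : Prop :=
  ¬ IsFull Tb x T v ∧ ¬ IsEmptyAt Tb x T v

/-- `v` is an `x`-leaf point: one child is `x`-empty and the other one is `x`-full. -/
def IsLeafPoint (Tb : RootedRankDecomposition V M) (x : M) (T : RootedRankDecomposition V N)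
    (v : N) : Prop :=
  ∃ c₁ ∈ T.tree.children v, ∃ c₂ ∈ T.tree.children v,
    c₁ ≠ c₂ ∧ IsEmptyAt Tb x T c₁ ∧ IsFull Tb x T c₂

/-- `v` is an `x`-branch point: both children are `x`-mixed. -/
def IsBranchPoint (Tb : RootedRankDecomposition V M) (x : M) (T : RootedRankDecomposition V N)
    (v : N) : Prop :=
  ∃ c₁ ∈ T.tree.children v, ∃ c₂ ∈ T.tree.children v,
    c₁ ≠ c₂ ∧ IsMixed Tb x T c₁ ∧ IsMixed Tb x T c₂

/-- The vertex set of the `x`-mixed skeleton of `T`. -/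
def skeletonVerts (Tb : RootedRankDecomposition V M) (x : M) (T : RootedRankDecomposition V N) :
    Set N :=
  {v | IsLeafPoint Tb x T v ∨ IsBranchPoint Tb x T v}

/-- The `x`-mixed skeleton of `T`: two distinct vertices are joined by an edge if the path between
them in the tree of `T` has no internal node in the skeleton; the root is the vertex that is an
ancestor in `T` of all the vertices. -/
def mixedSkeleton (Tb : RootedRankDecomposition V M) (x : M) (T : RootedRankDecomposition V N) :
    Skeleton N where
  verts := skeletonVerts Tb x T
  Adj u v := u ∈ skeletonVerts Tb x T ∧ v ∈ skeletonVerts Tb x T ∧ u ≠ v ∧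
    ∃ p : T.tree.graph.Walk u v, p.IsPath ∧
      ∀ w ∈ p.support, w ∈ skeletonVerts Tb x T → w = u ∨ w = v
  IsRoot v := v ∈ skeletonVerts Tb x T ∧ ∀ u ∈ skeletonVerts Tb x T, T.tree.Le u v

end RootedRankDecomposition

/-!
Let `X` be the set of members assigned to the descendants of `x` in `Tb`. Along a path of `T` the
members hanging off split into maximal runs inside `X` and inside `Xᶜ`. As one climbs the path, the
traces of the subtree and of its complement on the boundary of `X` grow and shrink monotonically, so
their *trace rank* takes at most `2 * ℓ + 1` values. Where it is constant, the connectivity function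
is modular on pairs of an increment inside `X` and an increment inside `Xᶜ`; hence two consecutive
runs whose common end node is at least as wide as the two outer end nodes can be exchanged without
increasing the width. Such an exchange preserves the skeletons and all factors that do not cross
`X`, and it creates a new factor of this kind, so that after finitely many exchanges none is
possible any more. Then, on a stretch without skeleton vertices where the trace rank is constant,
the width at the ends of the runs first decreases strictly and then increases strictly, so there are
at most `2 * (ℓ + 1)` runs. The members of `X` are finally collected into one factor for each
maximal run inside `X` and each skeleton vertex.
-/

namespace RootedTreeOn

variable {N : Type*} (T : RootedTreeOn N) {u v w a b : N}

theorem le_refl (u : N) : T.Le u u := ⟨0, rfl⟩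

theorem le_parent (u : N) : T.Le u (T.parent u) := ⟨1, rfl⟩

theorem le_root (u : N) : T.Le u T.root := T.reaches_root u

theorem iterate_parent_root (k : ℕ) : T.parent^[k] T.root = T.root :=
  Function.iterate_fixed T.parent_root k

variable {T}

theorem Le.trans (h : T.Le u v) (h' : T.Le v w) : T.Le u w := by
  obtain ⟨k, rfl⟩ := h
  obtain ⟨l, rfl⟩ := h'
  exact ⟨l + k, Function.iterate_add_apply _ _ _ _⟩

theorem eq_root_of_root_le (h : T.Le T.root w) : w = T.root := by
  obtain ⟨k, rfl⟩ := h
  exact T.iterate_parent_root k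

theorem Le.eq_or_parent_le (h : T.Le u w) : u = w ∨ T.Le (T.parent u) w := by
  obtain ⟨k, rfl⟩ := h
  cases k with
  | zero => exact Or.inl rfl
  | succ k => exact Or.inr ⟨k, rfl⟩

theorem Le.antisymm (h : T.Le u w) (h' : T.Le w u) : u = w := by
  obtain ⟨a, rfl⟩ := h
  obtain ⟨b, hb⟩ := h'
  have hperiod : T.parent^[b + a] u = u := by rw [Function.iterate_add_apply, hb]
  rcases Nat.eq_zero_or_pos (b + a) with h0 | hpos
  · obtain rfl : a = 0 := by omega
    rfl
  -- A node on a cycle of the parent map reaches the root only if it is the root.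
  · obtain ⟨k, hk⟩ := T.reaches_root u
    obtain ⟨l, hl⟩ := Nat.exists_eq_add_of_le (Nat.le_mul_of_pos_left k hpos)
    have hu : u = T.root := calc
      u = T.parent^[(b + a) * k] u := by
        rw [Function.iterate_mul, Function.iterate_fixed hperiod]
      _ = T.root := by
        rw [hl, Nat.add_comm, Function.iterate_add_apply, hk, T.iterate_parent_root]
    rw [hu, T.iterate_parent_root]

theorem Le.total (h : T.Le u a) (h' : T.Le u b) : T.Le a b ∨ T.Le b a := by
  obtain ⟨i, rfl⟩ := h
  obtain ⟨j, rfl⟩ := h'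
  rcases Nat.le_total i j with hij | hij
  · exact Or.inl ⟨j - i, by rw [← Function.iterate_add_apply, Nat.sub_add_cancel hij]⟩
  · exact Or.inr ⟨i - j, by rw [← Function.iterate_add_apply, Nat.sub_add_cancel hij]⟩

theorem Le.lt_of_ne (h : T.Le u w) (hne : u ≠ w) : T.Lt u w := ⟨h, hne⟩

theorem parent_ne (h : u ≠ T.root) : T.parent u ≠ u := by
  intro hfix
  obtain ⟨k, hk⟩ := T.reaches_root u
  rw [Function.iterate_fixed hfix k] at hk
  exact h hk

theorem lt_parent (h : u ≠ T.root) : T.Lt u (T.parent u) :=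
  ⟨T.le_parent u, (parent_ne h).symm⟩

theorem Lt.not_le (h : T.Lt u w) : ¬ T.Le w u := fun h' => h.2 (h.1.antisymm h')

theorem not_parent_le (h : u ≠ T.root) : ¬ T.Le (T.parent u) u := (lt_parent h).not_le

theorem Lt.ne_root (h : T.Lt u w) : u ≠ T.root := by
  rintro rfl
  exact h.2 (eq_root_of_root_le h.1).symm

theorem Lt.parent_le (h : T.Lt u w) : T.Le (T.parent u) w :=
  h.1.eq_or_parent_le.resolve_left h.2

theorem Lt.trans_le (h : T.Lt u v) (h' : T.Le v w) : T.Lt u w :=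
  ⟨h.1.trans h', fun e => h.not_le (e ▸ h')⟩

theorem Le.trans_lt (h : T.Le u v) (h' : T.Lt v w) : T.Lt u w :=
  ⟨h.trans h'.1, fun e => h'.not_le (e ▸ h)⟩

theorem Lt.trans (h : T.Lt u v) (h' : T.Lt v w) : T.Lt u w := h.trans_le h'.1

theorem root_induction {P : N → Prop} (root : P T.root)
    (step : ∀ u, u ≠ T.root → P (T.parent u) → P u) (u : N) : P u := by
  obtain ⟨k, hk⟩ := T.reaches_root u
  induction k generalizing u with
  | zero => exact (show u = T.root from hk) ▸ root
  | succ k ih =>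
    by_cases hu : u = T.root
    · exact hu ▸ root
    · exact step u hu (ih _ hk)

instance : IsTrans N T.Lt := ⟨fun _ _ _ => Lt.trans⟩

instance : Std.Irrefl T.Lt := ⟨fun _ h => h.2 rfl⟩

theorem downward_induction [Finite N] {P : N → Prop}
    (step : ∀ u, (∀ w, T.Lt w u → P w) → P u) (u : N) : P u :=
  (Finite.wellFounded_of_trans_of_irrefl T.Lt).induction u step

theorem exists_lowest [Finite N] {S : Set N} (hS : S.Nonempty) : ∃ u ∈ S, ∀ w ∈ S, ¬ T.Lt w u :=
  (Finite.wellFounded_of_trans_of_irrefl T.Lt).has_min S hS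

theorem upward_induction [Finite N] {P : N → Prop}
    (step : ∀ u, (∀ w, T.Lt u w → P w) → P u) (u : N) : P u :=
  (Finite.wellFounded_of_trans_of_irrefl (Function.swap T.Lt)).induction u step

theorem lt_of_mem_children (h : u ∈ T.children w) : T.Lt u w := by
  obtain ⟨hu, rfl⟩ := h
  exact lt_parent hu

theorem exists_child_of_lt (h : T.Lt u w) : ∃ c ∈ T.children w, T.Le u c := by
  obtain ⟨⟨k, hk⟩, hne⟩ := h
  induction k generalizing u with
  | zero => exact absurd hk hne
  | succ k ih =>
    have hu : u ≠ T.root := Lt.ne_root ⟨⟨k + 1, hk⟩, hne⟩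
    by_cases hparent : T.parent u = w
    · exact ⟨u, ⟨hu, hparent⟩, T.le_refl u⟩
    · obtain ⟨c, hc, hle⟩ := ih hparent hk
      exact ⟨c, hc, (T.le_parent u).trans hle⟩

theorem eq_of_mem_children_of_le_of_lt (hc : c ∈ T.children w) (hcu : T.Le c u)
    (huw : T.Lt u w) : c = u :=
  hcu.eq_or_parent_le.resolve_right fun h => huw.not_le (hc.2 ▸ h)

theorem eq_of_mem_children_of_le (ha : a ∈ T.children w) (hb : b ∈ T.children w)
    (h : T.Le a b) : a = b := by
  by_contra hne
  exact (lt_of_mem_children hb).not_le (ha.2 ▸ (h.lt_of_ne hne).parent_le)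

theorem eq_of_mem_children_of_common (ha : a ∈ T.children w) (hb : b ∈ T.children w)
    (hua : T.Le u a) (hub : T.Le u b) : a = b := by
  rcases hua.total hub with h | h
  · exact eq_of_mem_children_of_le ha hb h
  · exact (eq_of_mem_children_of_le hb ha h).symm

/-! ### Walks in the underlying tree -/

theorem mem_support_of_exit {c : N} (p : T.graph.Walk u v) (hu : T.Le u c) (hv : ¬ T.Le v c) :
    c ∈ p.support ∧ T.parent c ∈ p.support := by
  induction p with
  | nil => exact absurd hu hv
  | @cons x y z hxy p ih =>
    by_cases hy : T.Le y c
    · obtain ⟨hc, hparent⟩ := ih hy hv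
      exact ⟨List.mem_cons_of_mem _ hc, List.mem_cons_of_mem _ hparent⟩
    · have hxy' : T.parent x = y ∨ T.parent y = x := by
        simpa [graph, hxy.ne] using hxy
      rcases hxy' with rfl | rfl
      · rcases hu.eq_or_parent_le with rfl | h
        · simp
        · exact absurd h hy
      · exact absurd ((T.le_parent y).trans hu) hy

theorem exists_path_of_le (h : T.Le u v) :
    ∃ p : T.graph.Walk u v, p.IsPath ∧ ∀ w ∈ p.support, T.Le u w ∧ T.Le w v := by
  induction u using T.root_induction with
  | root =>
    obtain rfl := eq_root_of_root_le h
    exact ⟨.nil, by simp, by simp [T.le_refl]⟩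
  | step u hu ih =>
    rcases h.eq_or_parent_le with rfl | hparent
    · exact ⟨.nil, by simp, by simp [T.le_refl]⟩
    · obtain ⟨p, hp, hsupp⟩ := ih hparent
      have hadj : T.graph.Adj u (T.parent u) := by simp [graph, (parent_ne hu).symm]
      refine ⟨.cons hadj p, ?_, ?_⟩
      · rw [SimpleGraph.Walk.cons_isPath_iff]
        exact ⟨hp, fun hmem => not_parent_le hu (hsupp u hmem).1⟩
      · intro w hw
        rcases List.mem_cons.1 (SimpleGraph.Walk.support_cons hadj p ▸ hw) with rfl | hw
        · exact ⟨T.le_refl _, h⟩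
        · exact ⟨(T.le_parent u).trans (hsupp w hw).1, (hsupp w hw).2⟩

theorem exists_exit (hvu : ¬ T.Le v u) :
    ∃ c, T.Le u c ∧ ¬ T.Le v c ∧ T.Le v (T.parent c) := by
  induction u using T.root_induction with
  | root => exact absurd (T.le_root v) hvu
  | step u _ ih =>
    by_cases h : T.Le v (T.parent u)
    · exact ⟨u, T.le_refl u, hvu, h⟩
    · obtain ⟨c, huc, hc⟩ := ih h
      exact ⟨c, (T.le_parent u).trans huc, hc⟩

/-- The set `S` contains the join of any two of its incomparable members. The join is given as the
parent of the highest node `c` above only one of them. -/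
def JoinClosed (T : RootedTreeOn N) (S : Set N) : Prop :=
  ∀ u ∈ S, ∀ v ∈ S, ∀ c, ¬ T.Le u v → T.Le u c → ¬ T.Le v c → T.Le v (T.parent c) →
    T.parent c ∈ S

/-- The node `v` is above `u`, and the path between them has no internal node in `S`. -/
def Covers (T : RootedTreeOn N) (S : Set N) (u v : N) : Prop :=
  T.Le u v ∧ ∀ w ∈ S, T.Le u w → T.Le w v → w = u ∨ w = v

variable {S : Set N}

theorem Covers.exists_path (h : T.Covers S u v) :
    ∃ p : T.graph.Walk u v, p.IsPath ∧ ∀ w ∈ p.support, w ∈ S → w = u ∨ w = v := by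
  obtain ⟨p, hp, hsupp⟩ := exists_path_of_le h.1
  exact ⟨p, hp, fun w hwp hwS => h.2 w hwS (hsupp w hwp).1 (hsupp w hwp).2⟩

theorem covers_of_walk (p : T.graph.Walk u v) (hp : ∀ w ∈ p.support, w ∈ S → w = u ∨ w = v)
    (huv : T.Le u v) : T.Covers S u v := by
  refine ⟨huv, fun w hw huw hwv => ?_⟩
  by_cases hvw : T.Le v w
  · exact Or.inr (hwv.antisymm hvw)
  · exact hp w (mem_support_of_exit p huw hvw).1 hw

theorem exists_path_avoiding_iff (hS : T.JoinClosed S) (hu : u ∈ S) (hv : v ∈ S) :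
    (∃ p : T.graph.Walk u v, p.IsPath ∧ ∀ w ∈ p.support, w ∈ S → w = u ∨ w = v) ↔
      T.Covers S u v ∨ T.Covers S v u := by
  have reverse {u v : N} (p : T.graph.Walk u v) (hp : ∀ w ∈ p.support, w ∈ S → w = u ∨ w = v) :
      ∀ w ∈ p.reverse.support, w ∈ S → w = v ∨ w = u := fun w hwp hwS =>
    (hp w (by simpa using hwp) hwS).symm
  constructor
  · rintro ⟨p, -, hp⟩
    by_cases huv : T.Le u v
    · exact Or.inl (covers_of_walk p hp huv)
    by_cases hvu : T.Le v u
    · exact Or.inr (covers_of_walk p.reverse (reverse p hp) hvu)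
    -- A walk between incomparable nodes passes through their join.
    obtain ⟨c, huc, hvc, hvc'⟩ := exists_exit hvu
    have hmem := hS u hu v hv c huv huc hvc hvc'
    rcases hp _ (mem_support_of_exit p huc hvc).2 hmem with h | h
    · exact absurd (h ▸ hvc') hvu
    · exact absurd (h ▸ huc.trans (T.le_parent c)) huv
  · rintro (h | h)
    · exact h.exists_path
    · obtain ⟨p, hp, hsupp⟩ := h.exists_path
      exact ⟨p.reverse, hp.reverse, reverse p hsupp⟩

/-! ### Regrafting and exchanging blocks of a path -/

variable {M : Type*}

open Classical in
/-- The parent map of the tree obtained from `T` by renaming the nodes along `e`, where the subtree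
hanging below the edge above `c` becomes the one of the node `σ c`. -/
noncomputable def regraftParent (T : RootedTreeOn N) (e σ : N ≃ M) (u : M) : M :=
  if u = σ T.root then u else e (T.parent (σ.symm u))

/-- The tree with parent map `T.regraftParent e σ`: the children of `e w` are the images under `σ`
of the children of `w`. -/
noncomputable def regraft (T : RootedTreeOn N) (e σ : N ≃ M)
    (h : ∀ u, ∃ k : ℕ, (T.regraftParent e σ)^[k] u = σ T.root) : RootedTreeOn M where
  root := σ T.root
  parent := T.regraftParent e σ
  parent_root := if_pos rfl
  reaches_root := h

theorem children_regraft {T : RootedTreeOn N} {e σ : N ≃ M}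
    (h : ∀ u, ∃ k : ℕ, (T.regraftParent e σ)^[k] u = σ T.root) (w : N) :
    (T.regraft e σ h).children (e w) = σ '' T.children w := by
  ext c
  obtain ⟨c, rfl⟩ := σ.surjective c
  change σ c ≠ σ T.root ∧ T.regraftParent e σ (σ c) = e w ↔ σ c ∈ σ '' T.children w
  rw [σ.injective.mem_set_image, σ.injective.ne_iff]
  refine and_congr_right fun hc => ?_
  rw [regraftParent, if_neg (σ.injective.ne hc), σ.symm_apply_apply, e.injective.eq_iff]

theorem regraftParent_self_apply (T : RootedTreeOn N) (e : N ≃ M) (u : N) :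
    T.regraftParent e e (e u) = e (T.parent u) := by
  rw [regraftParent, e.symm_apply_apply]
  split_ifs with h
  · rw [e.injective h, T.parent_root]
  · rfl

theorem iterate_regraftParent_self (T : RootedTreeOn N) (e : N ≃ M) (k : ℕ) (u : N) :
    (T.regraftParent e e)^[k] (e u) = e (T.parent^[k] u) :=
  ((show Function.Semiconj e T.parent (T.regraftParent e e) from
    fun u => (T.regraftParent_self_apply e u).symm).iterate_right k u).symm

theorem regraftParent_self_reaches_root (T : RootedTreeOn N) (e : N ≃ M) (u : M) :
    ∃ k : ℕ, (T.regraftParent e e)^[k] u = e T.root := by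
  obtain ⟨u, rfl⟩ := e.surjective u
  obtain ⟨k, hk⟩ := T.reaches_root u
  exact ⟨k, by rw [iterate_regraftParent_self, hk]⟩

variable {p q c : N}

theorem exists_iterate_eq_of_apply {f : N → N} {r : N} (h : ∃ k : ℕ, f^[k] (f u) = r) :
    ∃ k : ℕ, f^[k] u = r := by
  obtain ⟨k, hk⟩ := h
  exact ⟨k + 1, hk⟩

theorem exists_iterate_eq_of_le {f : N → N} {r : N} (h : T.Le u w)
    (hf : ∀ z, T.Le u z → T.Lt z w → f z = T.parent z) (hw : ∃ k : ℕ, f^[k] w = r) :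
    ∃ k : ℕ, f^[k] u = r := by
  induction u using T.root_induction with
  | root => exact eq_root_of_root_le h ▸ hw
  | step u _ ih =>
    rcases eq_or_ne u w with rfl | hne
    · exact hw
    · refine exists_iterate_eq_of_apply ?_
      rw [hf u (T.le_refl u) (h.lt_of_ne hne)]
      exact ih (h.lt_of_ne hne).parent_le fun z hz => hf z ((T.le_parent u).trans hz)

open Classical in
/-- The permutation `v ↦ q`, `p ↦ v`, `q ↦ p`: exchanging the blocks `(v, p]` and `(p, q]` of a
path `v < p < q` puts `q` in the place of `v`, `v` in that of `p`, and `p` in that of `q`. -/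
noncomputable def blockPerm (v p q : N) : Equiv.Perm N := Equiv.swap v q * Equiv.swap p q

/-- The parent map after the exchange of the blocks `(v, p]` and `(p, q]`. -/
noncomputable abbrev swapParent (T : RootedTreeOn N) (v p q : N) : N → N :=
  T.regraftParent (Equiv.refl N) (blockPerm v p q)

section BlockSwap

theorem blockPerm_mid : blockPerm v p q p = v := by simp [blockPerm]

theorem blockPerm_of_ne (hv : c ≠ v) (hp : c ≠ p) (hq : c ≠ q) : blockPerm v p q c = c := by
  simp [blockPerm, Equiv.swap_apply_of_ne_of_ne, hv, hp, hq]

theorem swapParent_blockPerm (hc : c ≠ T.root) :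
    T.swapParent v p q (blockPerm v p q c) = T.parent c := by
  simp [regraftParent, hc]

theorem swapParent_of_ne (hc : c ≠ T.root) (hv : c ≠ v) (hp : c ≠ p) (hq : c ≠ q) :
    T.swapParent v p q c = T.parent c := by
  simpa only [blockPerm_of_ne hv hp hq] using swapParent_blockPerm (v := v) (p := p) (q := q) hc

variable (hvp : T.Lt v p) (hpq : T.Lt p q)

include hvp hpq

theorem blockPerm_bot : blockPerm v p q v = q := by
  classical
  simp [blockPerm, Equiv.swap_apply_of_ne_of_ne hvp.2 (hvp.trans hpq).2]

theorem blockPerm_top : blockPerm v p q q = p := by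
  classical
  simp [blockPerm, Equiv.swap_apply_of_ne_of_ne hvp.2.symm hpq.2]

theorem blockPerm_root_of_ne (hq : q ≠ T.root) : blockPerm v p q T.root = T.root :=
  blockPerm_of_ne hvp.ne_root.symm hpq.ne_root.symm hq.symm

theorem swapParent_mid_reaches_root :
    ∃ k : ℕ, (T.swapParent v p q)^[k] p = blockPerm v p q T.root := by
  by_cases hq : q = T.root
  · exact ⟨0, by rw [← hq, blockPerm_top hvp hpq]; rfl⟩
  have hparent : T.swapParent v p q p = T.parent q := by
    simpa only [blockPerm_top hvp hpq] using
      swapParent_blockPerm (v := v) (p := p) (q := q) hq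
  refine exists_iterate_eq_of_apply (hparent ▸ exists_iterate_eq_of_le (T.le_root _)
    (fun z hz hroot => ?_) ⟨0, (blockPerm_root_of_ne hvp hpq hq).symm⟩)
  have hqz := (lt_parent hq).trans_le hz
  have hpz := hpq.trans hqz
  exact swapParent_of_ne hroot.2 (hvp.trans hpz).2.symm hpz.2.symm hqz.2.symm

theorem swapParent_top_reaches_root :
    ∃ k : ℕ, (T.swapParent v p q)^[k] q = blockPerm v p q T.root := by
  have hparent : T.swapParent v p q q = T.parent v := by
    simpa only [blockPerm_bot hvp hpq] using
      swapParent_blockPerm (v := v) (p := p) (q := q) hvp.ne_root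
  refine exists_iterate_eq_of_apply (hparent ▸ exists_iterate_eq_of_le hvp.parent_le
    (fun z hz hzp => ?_) (swapParent_mid_reaches_root hvp hpq))
  exact swapParent_of_ne hzp.ne_root ((lt_parent hvp.ne_root).trans_le hz).2.symm hzp.2
    (hzp.trans hpq).2

theorem swapParent_bot_reaches_root :
    ∃ k : ℕ, (T.swapParent v p q)^[k] v = blockPerm v p q T.root := by
  have hparent : T.swapParent v p q v = T.parent p := by
    simpa only [blockPerm_mid] using
      swapParent_blockPerm (v := v) (p := p) (q := q) hpq.ne_root
  refine exists_iterate_eq_of_apply (hparent ▸ exists_iterate_eq_of_le hpq.parent_le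
    (fun z hz hzq => ?_) (swapParent_top_reaches_root hvp hpq))
  have hpz := (lt_parent hpq.ne_root).trans_le hz
  exact swapParent_of_ne hzq.ne_root (hvp.trans hpz).2.symm hpz.2.symm hzq.2

theorem swapParent_reaches_root (u : N) :
    ∃ k : ℕ, (T.swapParent v p q)^[k] u = blockPerm v p q T.root := by
  induction u using T.root_induction with
  | root =>
    by_cases hq : q = T.root
    · exact hq ▸ swapParent_top_reaches_root hvp hpq
    · exact ⟨0, (blockPerm_root_of_ne hvp hpq hq).symm⟩
  | step u hu ih =>
    by_cases huv : u = v
    · rw [huv]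
      exact swapParent_bot_reaches_root hvp hpq
    by_cases hup : u = p
    · rw [hup]
      exact swapParent_mid_reaches_root hvp hpq
    by_cases huq : u = q
    · rw [huq]
      exact swapParent_top_reaches_root hvp hpq
    exact exists_iterate_eq_of_apply (swapParent_of_ne hu huv hup huq ▸ ih)

omit hvp hpq

/-- The tree obtained by exchanging the blocks `(v, p]` and `(p, q]` of a path `v < p < q`. -/
noncomputable def swap (hvp : T.Lt v p) (hpq : T.Lt p q) : RootedTreeOn N :=
  T.regraft (Equiv.refl N) (blockPerm v p q) (swapParent_reaches_root hvp hpq)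

/-- The set of descendants of `w`. -/
def below (T : RootedTreeOn N) (w : N) : Set N := {u | T.Le u w}

theorem below_subset_of_le (h : T.Le u w) : T.below u ⊆ T.below w := fun _ hz => Le.trans hz h

theorem below_eq_insert (w : N) : T.below w = insert w (⋃ c ∈ T.children w, T.below c) := by
  ext u
  simp only [Set.mem_insert_iff, Set.mem_iUnion, exists_prop]
  constructor
  · intro h
    by_cases huw : u = w
    · exact Or.inl huw
    · exact Or.inr (exists_child_of_lt ⟨h, huw⟩)
  · rintro (rfl | ⟨c, hc, huc⟩)
    · exact T.le_refl u
    · exact Le.trans huc (lt_of_mem_children hc).1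

theorem below_eq_of_recursion [Finite N] {E : N → Set N}
    (hE : ∀ w, E w = insert w (⋃ c ∈ T.children w, E c)) (w : N) : T.below w = E w := by
  induction w using T.downward_induction with
  | step w ih =>
    rw [below_eq_insert, hE]
    exact congrArg _ (Set.iUnion₂_congr fun c hc => ih c (lt_of_mem_children hc))

open Classical in
/-- The descendants of `w` after the exchange of the blocks `(v, p]` and `(p, q]`. -/
noncomputable def swapBelow (T : RootedTreeOn N) (v p q w : N) : Set N :=
  if T.Lt v w ∧ T.Le w p then T.below w ∪ (T.below q \ T.below p)
  else if T.Lt p w ∧ T.Le w q then T.below v ∪ (T.below w \ T.below p)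
  else T.below w

theorem swapBelow_of_le_mid (hvw : T.Lt v w) (hwp : T.Le w p) :
    T.swapBelow v p q w = T.below w ∪ (T.below q \ T.below p) := if_pos ⟨hvw, hwp⟩

theorem swapBelow_of_mid_lt (hpw : T.Lt p w) (hwq : T.Le w q) :
    T.swapBelow v p q w = T.below v ∪ (T.below w \ T.below p) := by
  rw [swapBelow, if_neg fun h => hpw.not_le h.2, if_pos ⟨hpw, hwq⟩]

theorem swap_position (hvp : T.Lt v p) (q w : N) :
    ¬ (T.Lt v w ∧ T.Le w q) ∨ (T.Lt v w ∧ T.Le w p) ∨ (T.Lt p w ∧ T.Le w q) := by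
  by_cases hw : T.Lt v w ∧ T.Le w q
  · by_cases hwp : T.Le w p
    · exact Or.inr (Or.inl ⟨hw.1, hwp⟩)
    · have hpw := (hvp.1.total hw.1.1).resolve_right hwp
      exact Or.inr (Or.inr ⟨hpw.lt_of_ne fun e => hwp (e ▸ T.le_refl p), hw.2⟩)
  · exact Or.inl hw

include hvp hpq

theorem swapBelow_of_not_mem (hw : ¬ (T.Lt v w ∧ T.Le w q)) :
    T.swapBelow v p q w = T.below w := by
  rw [swapBelow, if_neg fun h => hw ⟨h.1, h.2.trans hpq.1⟩,
    if_neg fun h => hw ⟨hvp.trans h.1, h.2⟩]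

theorem swapBelow_blockPerm_of_lt_mid (hvc : T.Le v c) (hcp : T.Lt c p) :
    T.swapBelow v p q (blockPerm v p q c) = T.below c ∪ (T.below q \ T.below p) := by
  by_cases hcv : c = v
  · rw [hcv, blockPerm_bot hvp hpq, swapBelow_of_mid_lt hpq (T.le_refl q)]
  · rw [blockPerm_of_ne hcv hcp.2 (hcp.trans hpq).2,
      swapBelow_of_le_mid (hvc.lt_of_ne (Ne.symm hcv)) hcp.1]

theorem swapBelow_blockPerm_of_mid_le (hpc : T.Le p c) (hcq : T.Lt c q) :
    T.swapBelow v p q (blockPerm v p q c) = T.below v ∪ (T.below c \ T.below p) := by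
  by_cases hcp : c = p
  · rw [hcp, blockPerm_mid, swapBelow_of_not_mem hvp hpq fun h => h.1.2 rfl, sdiff_self,
      Set.bot_eq_empty, Set.union_empty]
  · rw [blockPerm_of_ne (hvp.trans_le hpc).2.symm hcp hcq.2,
      swapBelow_of_mid_lt (hpc.lt_of_ne (Ne.symm hcp)) hcq.1]

theorem swapBelow_blockPerm_of_not_mem (hc : ¬ (T.Le v c ∧ T.Lt c q)) :
    T.swapBelow v p q (blockPerm v p q c) = T.below c := by
  by_cases hcq : c = q
  · rw [hcq, blockPerm_top hvp hpq, swapBelow_of_le_mid hvp (T.le_refl p),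
      Set.union_sdiff_cancel (below_subset_of_le hpq.1)]
  · have hcv : c ≠ v := by
      rintro rfl
      exact hc ⟨T.le_refl c, hvp.trans hpq⟩
    have hcp : c ≠ p := by
      rintro rfl
      exact hc ⟨hvp.1, hpq⟩
    rw [blockPerm_of_ne hcv hcp hcq,
      swapBelow_of_not_mem hvp hpq fun h => hc ⟨h.1.1, h.2.lt_of_ne hcq⟩]

theorem swapBelow_eq_insert_of_not_mem (hw : ¬ (T.Lt v w ∧ T.Le w q)) :
    T.swapBelow v p q w =
      insert w (⋃ c ∈ T.children w, T.swapBelow v p q (blockPerm v p q c)) := by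
  rw [swapBelow_of_not_mem hvp hpq hw, below_eq_insert]
  refine congrArg _ (Set.iUnion₂_congr fun c hc => ?_)
  refine (swapBelow_blockPerm_of_not_mem hvp hpq fun h => hw ?_).symm
  exact ⟨h.1.trans_lt (lt_of_mem_children hc), hc.2 ▸ h.2.parent_le⟩

theorem swapBelow_eq_insert_of_le_mid (hvw : T.Lt v w) (hwp : T.Le w p) :
    T.swapBelow v p q w =
      insert w (⋃ c ∈ T.children w, T.swapBelow v p q (blockPerm v p q c)) := by
  have hon : ∀ c ∈ T.children w, T.Le v c → T.swapBelow v p q (blockPerm v p q c) =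
      T.below c ∪ (T.below q \ T.below p) := fun c hc hvc =>
    swapBelow_blockPerm_of_lt_mid hvp hpq hvc ((lt_of_mem_children hc).trans_le hwp)
  have hoff : ∀ c, ¬ T.Le v c → T.swapBelow v p q (blockPerm v p q c) = T.below c :=
    fun c hvc => swapBelow_blockPerm_of_not_mem hvp hpq fun h => hvc h.1
  obtain ⟨c₀, hc₀, hvc₀⟩ := exists_child_of_lt hvw
  rw [swapBelow_of_le_mid hvw hwp]
  ext u
  simp only [below_eq_insert w, Set.mem_union, Set.mem_insert_iff, Set.mem_iUnion, exists_prop]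
  constructor
  · rintro ((rfl | ⟨c, hc, hu⟩) | hu)
    · exact Or.inl rfl
    · refine Or.inr ⟨c, hc, ?_⟩
      by_cases hvc : T.Le v c
      · exact hon c hc hvc ▸ Or.inl hu
      · exact hoff c hvc ▸ hu
    · exact Or.inr ⟨c₀, hc₀, hon c₀ hc₀ hvc₀ ▸ Or.inr hu⟩
  · rintro (rfl | ⟨c, hc, hu⟩)
    · exact Or.inl (Or.inl rfl)
    · by_cases hvc : T.Le v c
      · rw [hon c hc hvc] at hu
        exact hu.imp_left fun hu => Or.inr ⟨c, hc, hu⟩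
      · exact Or.inl (Or.inr ⟨c, hc, hoff c hvc ▸ hu⟩)

theorem swapBelow_eq_insert_of_mid_lt (hpw : T.Lt p w) (hwq : T.Le w q) :
    T.swapBelow v p q w =
      insert w (⋃ c ∈ T.children w, T.swapBelow v p q (blockPerm v p q c)) := by
  have hon : ∀ c ∈ T.children w, T.Le p c → T.swapBelow v p q (blockPerm v p q c) =
      T.below v ∪ (T.below c \ T.below p) := fun c hc hpc =>
    swapBelow_blockPerm_of_mid_le hvp hpq hpc ((lt_of_mem_children hc).trans_le hwq)
  have hincomparable : ∀ c ∈ T.children w, ¬ T.Le p c → ¬ T.Le c p := fun c hc hpc hcp =>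
    hpw.not_le (hc.2 ▸ (hcp.lt_of_ne fun e => hpc (e ▸ T.le_refl c)).parent_le)
  have hoff : ∀ c ∈ T.children w, ¬ T.Le p c →
      T.swapBelow v p q (blockPerm v p q c) = T.below c := fun c hc hpc =>
    swapBelow_blockPerm_of_not_mem hvp hpq fun h =>
      (hvp.1.total h.1).elim hpc (hincomparable c hc hpc)
  obtain ⟨c₀, hc₀, hpc₀⟩ := exists_child_of_lt hpw
  rw [swapBelow_of_mid_lt hpw hwq]
  ext u
  simp only [below_eq_insert w, Set.mem_union, Set.mem_sdiff, Set.mem_insert_iff, Set.mem_iUnion,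
    exists_prop]
  constructor
  · rintro (hu | ⟨rfl | ⟨c, hc, hu⟩, hup⟩)
    · exact Or.inr ⟨c₀, hc₀, hon c₀ hc₀ hpc₀ ▸ Or.inl hu⟩
    · exact Or.inl rfl
    · refine Or.inr ⟨c, hc, ?_⟩
      by_cases hpc : T.Le p c
      · exact hon c hc hpc ▸ Or.inr ⟨hu, hup⟩
      · exact hoff c hc hpc ▸ hu
  · rintro (rfl | ⟨c, hc, hu⟩)
    · exact Or.inr ⟨Or.inl rfl, hpw.not_le⟩
    · by_cases hpc : T.Le p c
      · rw [hon c hc hpc] at hu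
        exact hu.imp_right fun hu => ⟨Or.inr ⟨c, hc, hu.1⟩, hu.2⟩
      · have huc : T.Le u c := (hoff c hc hpc ▸ hu : u ∈ T.below c)
        exact Or.inr ⟨Or.inr ⟨c, hc, huc⟩,
          fun hup => (huc.total hup).elim (hincomparable c hc hpc) hpc⟩

theorem swapBelow_eq_insert (w : N) :
    T.swapBelow v p q w =
      insert w (⋃ c ∈ T.children w, T.swapBelow v p q (blockPerm v p q c)) := by
  rcases swap_position hvp q w with hw | ⟨hvw, hwp⟩ | ⟨hpw, hwq⟩
  · exact swapBelow_eq_insert_of_not_mem hvp hpq hw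
  · exact swapBelow_eq_insert_of_le_mid hvp hpq hvw hwp
  · exact swapBelow_eq_insert_of_mid_lt hvp hpq hpw hwq

omit hvp hpq

theorem children_swap (hvp : T.Lt v p) (hpq : T.Lt p q) (w : N) :
    (swap hvp hpq).children w = blockPerm v p q '' T.children w :=
  children_regraft (swapParent_reaches_root hvp hpq) w

theorem below_swap [Finite N] (hvp : T.Lt v p) (hpq : T.Lt p q) (w : N) :
    (swap hvp hpq).below w = T.swapBelow v p q w := by
  refine below_eq_of_recursion (fun w => ?_) w
  rw [children_swap, Set.biUnion_image]
  exact swapBelow_eq_insert hvp hpq w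

end BlockSwap

end RootedTreeOn

namespace RootedRankDecomposition

open RootedTreeOn

variable {F : Type*} [Field F] {d : ℕ} {ι : Type*} {V : ι → Submodule F (Fin d → F)}
  {N M : Type*}

/-! ### Leaves and mixed skeletons -/

section Leaves

variable {T : RootedRankDecomposition V N} {X : Set ι} {u w a b : N} {i : ι}

theorem leaves_mono (h : T.tree.Le u w) : T.leaves u ⊆ T.leaves w :=
  fun _ hi => RootedTreeOn.Le.trans hi h

theorem le_total_of_mem_leaves (hu : i ∈ T.leaves u) (hw : i ∈ T.leaves w) :
    T.tree.Le u w ∨ T.tree.Le w u :=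
  RootedTreeOn.Le.total hu hw

theorem leaves_root (T : RootedRankDecomposition V N) : T.leaves T.tree.root = Set.univ :=
  Set.eq_univ_of_forall fun _ => T.tree.le_root _

theorem not_isLeaf_of_mem_children (ha : a ∈ T.tree.children w) : ¬ T.tree.IsLeaf w :=
  fun h => Set.eq_empty_iff_forall_notMem.1 h a ha

theorem exists_children_eq_pair (h : ¬ T.tree.IsLeaf w) :
    ∃ a b, a ≠ b ∧ T.tree.children w = {a, b} :=
  Set.ncard_eq_two.1 ((T.tree.leaf_or_two_children w).resolve_left h)

theorem exists_sibling (ha : a ∈ T.tree.children w) : ∃ b, a ≠ b ∧ T.tree.children w = {a, b} := by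
  obtain ⟨b, c, hbc, h⟩ := exists_children_eq_pair (not_isLeaf_of_mem_children ha)
  rcases h ▸ ha with rfl | rfl
  · exact ⟨c, hbc, h⟩
  · exact ⟨b, hbc.symm, h.trans (Set.pair_comm _ _)⟩

theorem leaves_eq_union (h : T.tree.children w = {a, b}) :
    T.leaves w = T.leaves a ∪ T.leaves b := by
  have ha : a ∈ T.tree.children w := h ▸ Set.mem_insert a {b}
  have hb : b ∈ T.tree.children w := h ▸ Set.mem_insert_of_mem a rfl
  refine Set.Subset.antisymm (fun i hi => ?_) (Set.union_subset
    (leaves_mono (lt_of_mem_children ha).1) (leaves_mono (lt_of_mem_children hb).1))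
  have hiw : (T.leaf i : N) ≠ w := fun e =>
    not_isLeaf_of_mem_children ha (e ▸ (T.leaf i).2)
  obtain ⟨c, hc, hic⟩ := exists_child_of_lt ⟨hi, hiw⟩
  rcases h ▸ hc with rfl | rfl
  · exact Or.inl hic
  · exact Or.inr hic

theorem disjoint_leaves_of_mem_children (ha : a ∈ T.tree.children w) (hb : b ∈ T.tree.children w)
    (hab : a ≠ b) : Disjoint (T.leaves a) (T.leaves b) :=
  Set.disjoint_left.2 fun _ hia hib => hab (eq_of_mem_children_of_common ha hb hia hib)

theorem leaves_nonempty [Finite N] (T : RootedRankDecomposition V N) (w : N) :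
    (T.leaves w).Nonempty := by
  induction w using T.tree.downward_induction with
  | step w ih =>
    by_cases hw : T.tree.IsLeaf w
    · refine ⟨T.leaf.symm ⟨w, hw⟩, ?_⟩
      simp [leaves, T.tree.le_refl]
    · obtain ⟨a, b, -, hab⟩ := exists_children_eq_pair hw
      have haw : T.tree.Lt a w := lt_of_mem_children (hab ▸ Set.mem_insert a {b})
      exact (ih a haw).mono (leaves_mono haw.1)

theorem leaves_subsingleton (h : T.tree.IsLeaf w) : (T.leaves w).Subsingleton := by
  have leaf_eq : ∀ i ∈ T.leaves w, (T.leaf i : N) = w := by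
    intro i hi
    by_contra hne
    obtain ⟨c, hc, -⟩ := exists_child_of_lt (hi.lt_of_ne hne)
    exact not_isLeaf_of_mem_children hc h
  exact fun i hi j hj =>
    T.leaf.injective (Subtype.ext ((leaf_eq i hi).trans (leaf_eq j hj).symm))

theorem leaves_sdiff_nonempty [Finite N] (h : T.tree.Lt u w) :
    (T.leaves w \ T.leaves u).Nonempty := by
  obtain ⟨c, hc, huc⟩ := exists_child_of_lt h
  obtain ⟨b, hcb, hw⟩ := exists_sibling hc
  have hb : b ∈ T.tree.children w := hw ▸ Set.mem_insert_of_mem c rfl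
  obtain ⟨i, hi⟩ := T.leaves_nonempty b
  exact ⟨i, leaves_mono (lt_of_mem_children hb).1 hi, fun hiu =>
    Set.disjoint_left.1 (disjoint_leaves_of_mem_children hc hb hcb) (leaves_mono huc hiu) hi⟩

/-- `A` lies on one side of the partition of `ι` into `X` and its complement. -/
def OneSided (X A : Set ι) : Prop := A ⊆ X ∨ A ⊆ Xᶜ

theorem oneSided_compl {A : Set ι} : OneSided Xᶜ A ↔ OneSided X A := by
  rw [OneSided, OneSided, compl_compl, or_comm]

theorem OneSided.mono {A B : Set ι} (h : OneSided X B) (hAB : A ⊆ B) : OneSided X A :=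
  h.imp hAB.trans hAB.trans

/-- The node `w` of `T` is `X`-mixed: it has leaves inside and outside of `X`. -/
def Mixed (T : RootedRankDecomposition V N) (X : Set ι) (w : N) : Prop :=
  ¬ T.leaves w ⊆ X ∧ ¬ T.leaves w ⊆ Xᶜ

theorem mixed_compl : T.Mixed Xᶜ w ↔ T.Mixed X w := by
  simp [Mixed, and_comm]

theorem not_mixed_iff : ¬ T.Mixed X w ↔ OneSided X (T.leaves w) := by
  rw [Mixed, OneSided, not_and_or, not_not, not_not]

theorem Mixed.mono (h : T.Mixed X u) (huw : T.tree.Le u w) : T.Mixed X w :=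
  ⟨fun hX => h.1 ((leaves_mono huw).trans hX), fun hX => h.2 ((leaves_mono huw).trans hX)⟩

theorem Mixed.not_isLeaf (h : T.Mixed X w) : ¬ T.tree.IsLeaf w := by
  intro hw
  obtain ⟨i, hi, hiX⟩ := Set.not_subset.1 h.1
  obtain ⟨j, hj, hjX⟩ := Set.not_subset.1 h.2
  exact hjX (leaves_subsingleton hw hi hj ▸ hiX)

/-- The node `w` is a vertex of the mixed skeleton of `T` with respect to an arbitrary set `X` in
place of a set `L(Tb)[x]`. -/
def SkeletonVertex (T : RootedRankDecomposition V N) (X : Set ι) (w : N) : Prop :=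
  ∃ a ∈ T.tree.children w, ∃ b ∈ T.tree.children w, a ≠ b ∧
    ((T.leaves a ⊆ Xᶜ ∧ T.leaves b ⊆ X) ∨ (T.Mixed X a ∧ T.Mixed X b))

theorem SkeletonVertex.compl (h : T.SkeletonVertex X w) : T.SkeletonVertex Xᶜ w := by
  obtain ⟨a, ha, b, hb, hab, ⟨haX, hbX⟩ | ⟨ha', hb'⟩⟩ := h
  · exact ⟨b, hb, a, ha, hab.symm, Or.inl ⟨hbX.trans_eq (compl_compl X).symm, haX⟩⟩
  · exact ⟨a, ha, b, hb, hab, Or.inr ⟨mixed_compl.2 ha', mixed_compl.2 hb'⟩⟩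

theorem skeletonVertex_compl : T.SkeletonVertex Xᶜ w ↔ T.SkeletonVertex X w :=
  ⟨fun h => compl_compl X ▸ h.compl, SkeletonVertex.compl⟩

theorem SkeletonVertex.mixed [Finite N] (h : T.SkeletonVertex X w) : T.Mixed X w := by
  obtain ⟨a, ha, b, hb, -, ⟨haX, hbX⟩ | h⟩ := h
  · obtain ⟨i, hi⟩ := T.leaves_nonempty a
    obtain ⟨j, hj⟩ := T.leaves_nonempty b
    exact ⟨fun hw => haX hi (hw (leaves_mono (lt_of_mem_children ha).1 hi)),
      fun hw => hw (leaves_mono (lt_of_mem_children hb).1 hj) (hbX hj)⟩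
  · exact h.1.mono (lt_of_mem_children ha).1

theorem Mixed.skeletonVertex_or (h : T.Mixed X w) :
    T.SkeletonVertex X w ∨
      ∃ c ∈ T.tree.children w, T.Mixed X c ∧ OneSided X (T.leaves w \ T.leaves c) := by
  obtain ⟨a, b, hab, hw⟩ := exists_children_eq_pair h.not_isLeaf
  have ha : a ∈ T.tree.children w := hw ▸ Set.mem_insert a {b}
  have hb : b ∈ T.tree.children w := hw ▸ Set.mem_insert_of_mem a rfl
  have hwab := leaves_eq_union hw
  have hwa : T.leaves w \ T.leaves a ⊆ T.leaves b := Set.sdiff_subset_iff.2 hwab.subset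
  have hwb : T.leaves w \ T.leaves b ⊆ T.leaves a :=
    Set.sdiff_subset_iff.2 (hwab.trans (Set.union_comm _ _)).subset
  by_cases ha' : T.Mixed X a <;> by_cases hb' : T.Mixed X b
  · exact Or.inl ⟨a, ha, b, hb, hab, Or.inr ⟨ha', hb'⟩⟩
  · exact Or.inr ⟨a, ha, ha', (not_mixed_iff.1 hb').mono hwa⟩
  · exact Or.inr ⟨b, hb, hb', (not_mixed_iff.1 ha').mono hwb⟩
  · rcases not_mixed_iff.1 ha' with haX | haX <;> rcases not_mixed_iff.1 hb' with hbX | hbX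
    · exact absurd (hwab ▸ Set.union_subset haX hbX) h.1
    · exact Or.inl ⟨b, hb, a, ha, hab.symm, Or.inl ⟨hbX, haX⟩⟩
    · exact Or.inl ⟨a, ha, b, hb, hab, Or.inl ⟨haX, hbX⟩⟩
    · exact absurd (hwab ▸ Set.union_subset haX hbX) h.2

end Leaves

section Skeleton

variable {Tb : RootedRankDecomposition V M} {y : M} {T T' : RootedRankDecomposition V N} {w : N}

theorem isEmptyAt_iff : IsEmptyAt Tb y T w ↔ T.leaves w ⊆ (Tb.leaves y)ᶜ :=
  Set.disjoint_iff_inter_eq_empty.symm.trans Set.subset_compl_iff_disjoint_right.symm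

theorem isMixed_iff : IsMixed Tb y T w ↔ T.Mixed (Tb.leaves y) w :=
  and_congr Iff.rfl (not_congr isEmptyAt_iff)

theorem mem_skeletonVerts_iff : w ∈ skeletonVerts Tb y T ↔ T.SkeletonVertex (Tb.leaves y) w := by
  change IsLeafPoint Tb y T w ∨ IsBranchPoint Tb y T w ↔ _
  simp only [IsLeafPoint, IsBranchPoint, SkeletonVertex, isEmptyAt_iff, isMixed_iff, IsFull,
    and_or_left, exists_or]

theorem joinClosed_setOf_skeletonVertex [Finite N] (T : RootedRankDecomposition V N) (X : Set ι) :
    T.tree.JoinClosed {w | T.SkeletonVertex X w} := by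
  intro u hu v hv c huv huc hvc hvp
  have hc : c ∈ T.tree.children (T.tree.parent c) :=
    ⟨fun e => hvc (e ▸ T.tree.le_root v), rfl⟩
  obtain ⟨b, hb, hvb⟩ :=
    exists_child_of_lt (hvp.lt_of_ne fun e => huv (e ▸ huc.trans (T.tree.le_parent c)))
  exact ⟨c, hc, b, hb, fun e => hvc (e ▸ hvb), Or.inr ⟨hu.mixed.mono huc, hv.mixed.mono hvb⟩⟩

theorem skeletonVerts_eq_setOf (Tb : RootedRankDecomposition V M) (y : M)
    (T : RootedRankDecomposition V N) :
    skeletonVerts Tb y T = {w | T.SkeletonVertex (Tb.leaves y) w} :=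
  Set.ext fun _ => mem_skeletonVerts_iff

theorem mixedSkeleton_adj_iff [Finite N] {u v : N} : (mixedSkeleton Tb y T).Adj u v ↔
    u ∈ skeletonVerts Tb y T ∧ v ∈ skeletonVerts Tb y T ∧ u ≠ v ∧
      (T.tree.Covers (skeletonVerts Tb y T) u v ∨ T.tree.Covers (skeletonVerts Tb y T) v u) :=
  and_congr_right fun hu => and_congr_right fun hv => and_congr_right fun _ =>
    exists_path_avoiding_iff
      (skeletonVerts_eq_setOf Tb y T ▸ T.joinClosed_setOf_skeletonVertex _) hu hv

theorem mixedSkeleton_eq [Finite N] (hverts : skeletonVerts Tb y T' = skeletonVerts Tb y T)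
    (hle : ∀ u ∈ skeletonVerts Tb y T, ∀ w ∈ skeletonVerts Tb y T,
      T'.tree.Le u w ↔ T.tree.Le u w) :
    mixedSkeleton Tb y T' = mixedSkeleton Tb y T := by
  have hcovers : ∀ u ∈ skeletonVerts Tb y T, ∀ w ∈ skeletonVerts Tb y T,
      (T'.tree.Covers (skeletonVerts Tb y T) u w ↔ T.tree.Covers (skeletonVerts Tb y T) u w) :=
    fun u hu w hw => and_congr (hle u hu w hw) <| forall₂_congr fun z hz => by
      rw [hle u hu z hz, hle z hz w hw]
  have hadj : (mixedSkeleton Tb y T').Adj = (mixedSkeleton Tb y T).Adj := by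
    ext u w
    rw [mixedSkeleton_adj_iff, mixedSkeleton_adj_iff, hverts]
    exact and_congr_right fun hu => and_congr_right fun hw => and_congr_right fun _ =>
      or_congr (hcovers u hu w hw) (hcovers w hw u hu)
  have hroot : (mixedSkeleton Tb y T').IsRoot = (mixedSkeleton Tb y T).IsRoot := by
    ext w
    change (w ∈ skeletonVerts Tb y T' ∧ ∀ u ∈ skeletonVerts Tb y T', _) ↔ _
    rw [hverts]
    exact and_congr_right fun hw => forall₂_congr fun u hu => hle u hu w hw
  calc mixedSkeleton Tb y T'
      = ⟨skeletonVerts Tb y T', (mixedSkeleton Tb y T').Adj, (mixedSkeleton Tb y T').IsRoot⟩ := rfl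
    _ = _ := by rw [hverts, hadj, hroot]; rfl

end Skeleton

section Regraft

/-- The decomposition `T` carried over to the tree `T.tree.regraft e σ h`, a leaf `w` becoming the
leaf `e w`. -/
noncomputable def regraft (T : RootedRankDecomposition V N) (e σ : N ≃ M)
    (h : ∀ u, ∃ k : ℕ, (T.tree.regraftParent e σ)^[k] u = σ T.tree.root) :
    RootedRankDecomposition V M :=
  have isLeaf_iff : ∀ w, (T.tree.toRootedTreeOn.regraft e σ h).IsLeaf (e w) ↔ T.tree.IsLeaf w :=
    fun w => by rw [IsLeaf, children_regraft, Set.image_eq_empty, IsLeaf]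
  { tree :=
      { T.tree.toRootedTreeOn.regraft e σ h with
        leaf_or_two_children := e.surjective.forall.2 fun w => by
          rw [isLeaf_iff, children_regraft, Set.ncard_image_of_injective _ σ.injective]
          exact T.tree.leaf_or_two_children w
        two_leaves := by
          obtain ⟨a, ha, b, hb, hab⟩ := T.tree.two_leaves
          exact ⟨e a, (isLeaf_iff a).2 ha, e b, (isLeaf_iff b).2 hb, e.injective.ne hab⟩ }
    leaf := T.leaf.trans (e.subtypeEquiv fun w => (isLeaf_iff w).symm) }

/-- The decomposition `T` with its nodes renamed along `e`. -/
noncomputable def relabel (T : RootedRankDecomposition V N) (e : N ≃ M) :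
    RootedRankDecomposition V M :=
  T.regraft e e (T.tree.regraftParent_self_reaches_root e)

theorem leaves_relabel (T : RootedRankDecomposition V N) (e : N ≃ M) (w : N) :
    (T.relabel e).leaves (e w) = T.leaves w := by
  ext i
  refine exists_congr fun k => ?_
  change (T.tree.regraftParent e e)^[k] (e (T.leaf i)) = e w ↔ _
  rw [iterate_regraftParent_self, e.injective.eq_iff]

end Regraft

section Swap

variable {T : RootedRankDecomposition V N} {v p q u w c : N}

/-- The decomposition obtained by exchanging the blocks `(v, p]` and `(p, q]` of a path. -/
noncomputable def swap (T : RootedRankDecomposition V N) (hvp : T.tree.Lt v p)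
    (hpq : T.tree.Lt p q) : RootedRankDecomposition V N :=
  T.regraft (Equiv.refl N) (blockPerm v p q) (swapParent_reaches_root hvp hpq)

variable (hvp : T.tree.Lt v p) (hpq : T.tree.Lt p q)

theorem children_swap (w : N) :
    (T.swap hvp hpq).tree.children w = blockPerm v p q '' T.tree.children w :=
  RootedTreeOn.children_swap hvp hpq w

variable [Finite N]

theorem le_swap_iff : (T.swap hvp hpq).tree.Le u w ↔ u ∈ T.tree.swapBelow v p q w :=
  Set.ext_iff.1 (below_swap hvp hpq w) u

theorem leaves_swap (w : N) :
    (T.swap hvp hpq).leaves w = (fun i => (T.leaf i : N)) ⁻¹' T.tree.swapBelow v p q w :=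
  Set.ext fun _ => le_swap_iff hvp hpq

theorem leaves_swap_of_not_mem (hw : ¬ (T.tree.Lt v w ∧ T.tree.Le w q)) :
    (T.swap hvp hpq).leaves w = T.leaves w := by
  rw [leaves_swap, swapBelow_of_not_mem hvp hpq hw]
  rfl

theorem leaves_swap_of_le_mid (hvw : T.tree.Lt v w) (hwp : T.tree.Le w p) :
    (T.swap hvp hpq).leaves w = T.leaves w ∪ (T.leaves q \ T.leaves p) := by
  rw [leaves_swap, swapBelow_of_le_mid hvw hwp]
  rfl

theorem leaves_swap_of_mid_lt (hpw : T.tree.Lt p w) (hwq : T.tree.Le w q) :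
    (T.swap hvp hpq).leaves w = T.leaves v ∪ (T.leaves w \ T.leaves p) := by
  rw [leaves_swap, swapBelow_of_mid_lt hpw hwq]
  rfl

theorem leaves_swap_mid : (T.swap hvp hpq).leaves p = T.leaves q := by
  rw [leaves_swap_of_le_mid hvp hpq hvp (T.tree.le_refl p),
    Set.union_sdiff_cancel (leaves_mono hpq.1)]

theorem leaves_swap_top :
    (T.swap hvp hpq).leaves q = T.leaves v ∪ (T.leaves q \ T.leaves p) :=
  leaves_swap_of_mid_lt hvp hpq hpq (T.tree.le_refl q)

theorem leaves_swap_bot : (T.swap hvp hpq).leaves v = T.leaves v :=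
  leaves_swap_of_not_mem hvp hpq fun h => h.1.2 rfl

theorem leaves_swap_blockPerm_of_lt_mid (hvc : T.tree.Le v c) (hcp : T.tree.Lt c p) :
    (T.swap hvp hpq).leaves (blockPerm v p q c) = T.leaves c ∪ (T.leaves q \ T.leaves p) := by
  rw [leaves_swap, swapBelow_blockPerm_of_lt_mid hvp hpq hvc hcp]
  rfl

theorem leaves_swap_blockPerm_of_mid_le (hpc : T.tree.Le p c) (hcq : T.tree.Lt c q) :
    (T.swap hvp hpq).leaves (blockPerm v p q c) = T.leaves v ∪ (T.leaves c \ T.leaves p) := by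
  rw [leaves_swap, swapBelow_blockPerm_of_mid_le hvp hpq hpc hcq]
  rfl

theorem leaves_swap_blockPerm_of_not_mem (hc : ¬ (T.tree.Le v c ∧ T.tree.Lt c q)) :
    (T.swap hvp hpq).leaves (blockPerm v p q c) = T.leaves c := by
  rw [leaves_swap, swapBelow_blockPerm_of_not_mem hvp hpq hc]
  rfl

end Swap

/-! ### Runs of a path -/

section Runs

variable {T : RootedRankDecomposition V N} {X C : Set ι} {c r r' r₁ t u w : N}

theorem Mixed.le_total (hu : T.Mixed X u) (hur : T.tree.Le u r)
    (h : OneSided X (T.leaves r \ T.leaves t)) : T.tree.Le u t ∨ T.tree.Le t u := by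
  obtain ⟨i, hiu, hit⟩ : ∃ i ∈ T.leaves u, i ∈ T.leaves t := by
    by_contra! hdisj
    have hsub : T.leaves u ⊆ T.leaves r \ T.leaves t :=
      fun i hi => ⟨leaves_mono hur hi, hdisj i hi⟩
    exact not_mixed_iff.2 (h.mono hsub) hu
  exact le_total_of_mem_leaves hiu hit

theorem Mixed.le_child (hu : T.Mixed X u) (huw : T.tree.Lt u w) (hc : c ∈ T.tree.children w)
    (h : OneSided X (T.leaves w \ T.leaves c)) : T.tree.Le u c := by
  rcases hu.le_total huw.1 h with huc | hcu
  · exact huc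
  · exact eq_of_mem_children_of_le_of_lt hc hcu huw ▸ T.tree.le_refl c

theorem Mixed.exists_highest_vertex [Finite N] (h : T.Mixed X r) :
    ∃ s, T.SkeletonVertex X s ∧ T.tree.Le s r ∧
      ∀ u, T.SkeletonVertex X u → T.tree.Le u r → T.tree.Le u s := by
  induction r using T.tree.downward_induction with
  | step r ih =>
    by_cases hr : T.SkeletonVertex X r
    · exact ⟨r, hr, T.tree.le_refl r, fun _ _ h => h⟩
    · obtain ⟨c, hc, hcm, hrc⟩ := h.skeletonVertex_or.resolve_left hr
      have hcr := lt_of_mem_children hc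
      obtain ⟨s, hs, hsc, hmax⟩ := ih c hcr hcm
      refine ⟨s, hs, hsc.trans hcr.1, fun u hu hur => hmax u hu ?_⟩
      exact hu.mixed.le_child (hur.lt_of_ne fun e => hr (e ▸ hu)) hc hrc

theorem exists_highest_extension [Finite N] (h : T.leaves t \ T.leaves r ⊆ C) :
    ∃ r₁, T.tree.Le t r₁ ∧ T.leaves r₁ \ T.leaves r ⊆ C ∧
      ∀ t', T.tree.Lt r₁ t' → ¬ T.leaves t' \ T.leaves r₁ ⊆ C := by
  induction t using T.tree.upward_induction with
  | step t ih =>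
    by_cases hext : ∃ t', T.tree.Lt t t' ∧ T.leaves t' \ T.leaves t ⊆ C
    · obtain ⟨t', htt', ht'⟩ := hext
      obtain ⟨r₁, hle, hr₁⟩ := ih t' htt' <|
        (sdiff_triangle _ (T.leaves t) _).trans (Set.union_subset ht' h)
      exact ⟨r₁, htt'.1.trans hle, hr₁⟩
    · push Not at hext
      exact ⟨t, T.tree.le_refl t, h, hext⟩

/-- A run of `C`: a path from an ancestor `r` down to a mixed node `c` such that all the subtrees
hanging off it contain members of `C` only. -/
structure Run (T : RootedRankDecomposition V N) (C : Set ι) (c r : N) : Prop where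
  lt : T.tree.Lt c r
  mixed : T.Mixed C c
  subset : T.leaves r \ T.leaves c ⊆ C

/-- `r` is the upper end of a run of `C` that cannot be prolonged upwards. -/
def RunTop (T : RootedRankDecomposition V N) (C : Set ι) (r : N) : Prop :=
  (∃ c, T.Run C c r) ∧ ∀ t, T.tree.Lt r t → ¬ T.leaves t \ T.leaves r ⊆ C

/-- A run of `C` that cannot be prolonged upwards and starts at the end of such a run of `Cᶜ`. -/
structure MaximalRun (T : RootedRankDecomposition V N) (C : Set ι) (r r' : N) : Prop
    extends T.Run C r r' where
  base : T.RunTop Cᶜ r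
  top : T.RunTop C r'

/-- The run tops `r < r'` of `X` or of `Xᶜ` are consecutive on a path towards the root. -/
def NextRunTop (T : RootedRankDecomposition V N) (X : Set ι) (r r' : N) : Prop :=
  T.MaximalRun X r r' ∨ T.MaximalRun Xᶜ r r'

theorem Run.not_sdiff_subset_compl [Finite N] (h : T.Run C c r) (htr : T.tree.Lt t r) :
    ¬ T.leaves r \ T.leaves t ⊆ Cᶜ := by
  intro h'
  rcases h.mixed.le_total h.lt.1 (Or.inr h') with hct | htc
  · obtain ⟨i, hi⟩ := leaves_sdiff_nonempty htr
    exact h' hi (h.subset ⟨hi.1, fun hic => hi.2 (leaves_mono hct hic)⟩)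
  · obtain ⟨i, hi⟩ := leaves_sdiff_nonempty h.lt
    exact h' ⟨hi.1, fun hit => hi.2 (leaves_mono htc hit)⟩ (h.subset hi)

theorem RunTop.mixed (h : T.RunTop C r) : T.Mixed C r :=
  have ⟨_, hc⟩ := h.1
  hc.mixed.mono hc.lt.1

theorem RunTop.not_compl [Finite N] (h : T.RunTop C r) : ¬ T.RunTop Cᶜ r := by
  obtain ⟨⟨c, hc⟩, -⟩ := h
  rintro ⟨⟨t, ht⟩, -⟩
  exact hc.not_sdiff_subset_compl ht.lt ht.subset

theorem RunTop.exists_maximalRun [Finite N] (hr : T.RunTop Cᶜ r) (hroot : r ≠ T.tree.root)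
    (hv : ¬ T.SkeletonVertex C (T.tree.parent r)) : ∃ r₁, T.MaximalRun C r r₁ := by
  have hmixed : T.Mixed C r := mixed_compl.1 hr.mixed
  have hlt := lt_parent hroot
  obtain ⟨c, hc, -, hcw⟩ := (hmixed.mono hlt.1).skeletonVertex_or.resolve_left hv
  obtain rfl : r = c := eq_of_mem_children_of_le ⟨hroot, rfl⟩ hc (hmixed.le_child hlt hc hcw)
  obtain ⟨r₁, hle, hsub, hmax⟩ := exists_highest_extension (hcw.resolve_right (hr.2 _ hlt))
  have hrun : T.Run C r r₁ := ⟨hlt.trans_le hle, hmixed, hsub⟩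
  exact ⟨r₁, hrun, hr, ⟨r, hrun⟩, hmax⟩

theorem MaximalRun.le_of_runTop [Finite N] (h : T.MaximalRun C r r₁)
    (hr' : T.RunTop C r' ∨ T.RunTop Cᶜ r') (hrr' : T.tree.Lt r r') : T.tree.Le r₁ r' := by
  by_contra hnle
  have hlt : T.tree.Lt r' r₁ := ((h.lt.1.total hrr'.1).resolve_left hnle).lt_of_ne fun e =>
    hnle (e ▸ T.tree.le_refl _)
  rcases hr' with ⟨-, hmax⟩ | ⟨⟨b, hb⟩, -⟩
  · exact hmax r₁ hlt ((Set.sdiff_subset_sdiff_right (leaves_mono hrr'.1)).trans h.subset)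
  · exact hb.not_sdiff_subset_compl hrr' <|
      (Set.sdiff_subset_sdiff_left (leaves_mono hlt.1)).trans
        (h.subset.trans_eq (compl_compl C).symm)

theorem NextRunTop.lt (h : T.NextRunTop X r r') : T.tree.Lt r r' :=
  h.elim (fun h => h.lt) fun h => h.lt

theorem NextRunTop.runTop_right (h : T.NextRunTop X r r') : T.RunTop X r' ∨ T.RunTop Xᶜ r' :=
  h.imp (fun h => h.top) fun h => h.top

theorem NextRunTop.le_of_runTop [Finite N] (h : T.NextRunTop X r r₁)
    (hr' : T.RunTop X r' ∨ T.RunTop Xᶜ r') (hrr' : T.tree.Lt r r') : T.tree.Le r₁ r' := by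
  rcases h with h | h
  · exact h.le_of_runTop hr' hrr'
  · exact h.le_of_runTop (by rwa [compl_compl, or_comm]) hrr'

theorem exists_nextRunTop [Finite N] (hr : T.RunTop X r ∨ T.RunTop Xᶜ r)
    (hroot : r ≠ T.tree.root) (hv : ¬ T.SkeletonVertex X (T.tree.parent r)) :
    ∃ r₁, T.NextRunTop X r r₁ := by
  rcases hr with hr | hr
  · obtain ⟨r₁, h⟩ := RunTop.exists_maximalRun (C := Xᶜ) (by rwa [compl_compl]) hroot
      (by rwa [skeletonVertex_compl])
    exact ⟨r₁, Or.inr h⟩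
  · obtain ⟨r₁, h⟩ := hr.exists_maximalRun hroot hv
    exact ⟨r₁, Or.inl h⟩

theorem transGen_nextRunTop [Finite N] (hr : T.RunTop X r ∨ T.RunTop Xᶜ r)
    (hr' : T.RunTop X r' ∨ T.RunTop Xᶜ r') (hrr' : T.tree.Lt r r')
    (hv : ∀ w, T.tree.Lt r w → T.tree.Le w r' → ¬ T.SkeletonVertex X w) :
    Relation.TransGen (T.NextRunTop X) r r' := by
  induction r using T.tree.upward_induction with
  | step r ih =>
    obtain ⟨r₁, hnext⟩ :=
      exists_nextRunTop hr hrr'.ne_root (hv _ (lt_parent hrr'.ne_root) hrr'.parent_le)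
    rcases eq_or_ne r₁ r' with rfl | hne
    · exact .single hnext
    · have hlt : T.tree.Lt r₁ r' := (hnext.le_of_runTop hr' hrr').lt_of_ne hne
      exact .head hnext (ih r₁ hnext.lt hnext.runTop_right hlt fun w hw => hv w (hnext.lt.trans hw))

theorem lt_of_transGen_nextRunTop (h : Relation.TransGen (T.NextRunTop X) r r') :
    T.tree.Lt r r' := by
  induction h with
  | single h => exact h.lt
  | tail _ h ih => exact ih.trans h.lt

end Runs

/-! ### Skeletons and factors after an exchange -/

section SwapSkeleton

variable {T T' : RootedRankDecomposition V N} {X Y C A B G : Set ι} {v p q b u w c : N}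

/-- The skeletons of `T` and `T'` with respect to `Y` have the same vertices in the same order. -/
def SameSkeleton (T T' : RootedRankDecomposition V N) (Y : Set ι) : Prop :=
  (∀ w, T'.SkeletonVertex Y w ↔ T.SkeletonVertex Y w) ∧
    ∀ u w, T.SkeletonVertex Y u → T.SkeletonVertex Y w → (T'.tree.Le u w ↔ T.tree.Le u w)

/-- `A` and `B` agree on being contained in `Y` and on being contained in `Yᶜ`. -/
def SameStatus (Y A B : Set ι) : Prop := (A ⊆ Y ↔ B ⊆ Y) ∧ (A ⊆ Yᶜ ↔ B ⊆ Yᶜ)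

/-- The partitions of `ι` given by `X` and by `Y` do not cross: one of the four intersections of
their sides is empty. -/
def Uncrossed (X Y : Set ι) : Prop := Y ⊆ X ∨ X ⊆ Y ∨ Y ⊆ Xᶜ ∨ Xᶜ ⊆ Y

theorem uncrossed_compl : Uncrossed Xᶜ Y ↔ Uncrossed X Y := by
  simp only [Uncrossed, compl_compl]
  tauto

theorem sameSkeleton_compl : SameSkeleton T T' Yᶜ ↔ SameSkeleton T T' Y := by
  simp only [SameSkeleton, skeletonVertex_compl]

theorem SameStatus.refl (Y A : Set ι) : SameStatus Y A A := ⟨Iff.rfl, Iff.rfl⟩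

theorem SameStatus.symm (h : SameStatus Y A B) : SameStatus Y B A := ⟨h.1.symm, h.2.symm⟩

theorem sameStatus_union (hA : ¬ A ⊆ Y) (hG : G ⊆ Yᶜ) : SameStatus Y (A ∪ G) A :=
  ⟨⟨Set.subset_union_left.trans, fun h => absurd h hA⟩,
    ⟨Set.subset_union_left.trans, fun h => Set.union_subset h hG⟩⟩

theorem skeletonVertex_iff_of_children (σ : Equiv.Perm N)
    (hch : T'.tree.children w = σ '' T.tree.children w)
    (hst : ∀ c ∈ T.tree.children w, SameStatus Y (T'.leaves (σ c)) (T.leaves c)) :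
    T'.SkeletonVertex Y w ↔ T.SkeletonVertex Y w := by
  unfold SkeletonVertex
  rw [hch]
  simp only [Set.exists_mem_image]
  refine exists_congr fun a => and_congr_right fun ha => exists_congr fun b =>
    and_congr_right fun hb => ?_
  simp only [Mixed, (hst a ha).1, (hst a ha).2, (hst b hb).1, (hst b hb).2, ne_eq,
    EmbeddingLike.apply_eq_iff_eq]

theorem le_child_or_disjoint (hbw : T.tree.Lt b w) (hc : c ∈ T.tree.children w) :
    T.tree.Le b c ∨ Disjoint (T.leaves c) (T.leaves b) := by
  by_cases h : Disjoint (T.leaves c) (T.leaves b)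
  · exact Or.inr h
  · obtain ⟨i, hic, hib⟩ := Set.not_disjoint_iff.1 h
    rcases le_total_of_mem_leaves hib hic with hbc | hcb
    · exact Or.inl hbc
    · exact Or.inl (eq_of_mem_children_of_le_of_lt hc hcb hbw ▸ T.tree.le_refl c)

theorem not_skeletonVertex_of_sdiff_subset [Finite N] (hG : T.leaves p \ T.leaves b ⊆ Yᶜ)
    (hb : ¬ T.leaves b ⊆ Y) (hbw : T.tree.Lt b w) (hwp : T.tree.Le w p) :
    ¬ T.SkeletonVertex Y w := by
  have le_or_subset : ∀ c ∈ T.tree.children w, T.tree.Le b c ∨ T.leaves c ⊆ Yᶜ := fun c hc =>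
    (le_child_or_disjoint hbw hc).imp_right fun h i hi =>
      hG ⟨leaves_mono ((lt_of_mem_children hc).1.trans hwp) hi, Set.disjoint_left.1 h hi⟩
  rintro ⟨a, ha, a', ha', haa', ⟨-, h⟩ | ⟨h, h'⟩⟩
  · rcases le_or_subset a' ha' with hba' | hsub
    · exact hb ((leaves_mono hba').trans h)
    · obtain ⟨i, hi⟩ := T.leaves_nonempty a'
      exact hsub hi (h hi)
  · exact haa' (eq_of_mem_children_of_common ha ha' ((le_or_subset a ha).resolve_right h.2)
      ((le_or_subset a' ha').resolve_right h'.2))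

theorem SkeletonVertex.le_of_sdiff_subset [Finite N] (hu : T.SkeletonVertex Y u)
    (hG : T.leaves p \ T.leaves b ⊆ Yᶜ) (hb : ¬ T.leaves b ⊆ Y) (hup : T.tree.Le u p) :
    T.tree.Le u b := by
  rcases hu.mixed.le_total hup (Or.inr hG) with hub | hbu
  · exact hub
  · by_contra hnle
    exact not_skeletonVertex_of_sdiff_subset hG hb
      (hbu.lt_of_ne fun e => hnle (e ▸ T.tree.le_refl b)) hup hu

theorem not_le_lt_or_le_lt_mid_or_mid_le_lt (hvp : T.tree.Lt v p) (q c : N) :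
    ¬ (T.tree.Le v c ∧ T.tree.Lt c q) ∨ (T.tree.Le v c ∧ T.tree.Lt c p) ∨
      (T.tree.Le p c ∧ T.tree.Lt c q) := by
  by_cases h : T.tree.Le v c ∧ T.tree.Lt c q
  · rcases h.1.total hvp.1 with hcp | hpc
    · rcases eq_or_ne c p with rfl | hne
      · exact Or.inr (Or.inr ⟨hcp, h.2⟩)
      · exact Or.inr (Or.inl ⟨h.1, hcp.lt_of_ne hne⟩)
    · exact Or.inr (Or.inr ⟨hpc, h.2⟩)
  · exact Or.inl h

variable [Finite N] (hvp : T.tree.Lt v p) (hpq : T.tree.Lt p q)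

section LowerBlock

variable (hP : T.leaves p \ T.leaves v ⊆ Yᶜ) (hv : ¬ T.leaves v ⊆ Y)

include hP hv

theorem not_skeletonVertex_swap_of_le_mid (hvw : T.tree.Lt v w) (hwp : T.tree.Le w p) :
    ¬ (T.swap hvp hpq).SkeletonVertex Y w := by
  refine not_skeletonVertex_of_sdiff_subset (b := q) (p := p) ?_ ?_ ⟨?_, ?_⟩ ?_
  · rw [leaves_swap_mid, leaves_swap_top]
    rintro i ⟨hiq, hi⟩
    exact hP ⟨by_contra fun hip => hi (Or.inr ⟨hiq, hip⟩), fun hiv => hi (Or.inl hiv)⟩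
  · rw [leaves_swap_top]
    exact fun h => hv (Set.subset_union_left.trans h)
  · rw [le_swap_iff, swapBelow_of_le_mid hvw hwp]
    exact Or.inr ⟨T.tree.le_refl q, hpq.not_le⟩
  · rintro rfl
    exact hpq.not_le hwp
  · rw [le_swap_iff, swapBelow_of_le_mid hvp (T.tree.le_refl p)]
    exact Or.inl hwp

omit [Finite N] in
theorem sameStatus_swap_of_lower (hvc : T.tree.Le v c) :
    SameStatus Y (T.leaves v ∪ (T.leaves c \ T.leaves p)) (T.leaves c) := by
  have hsub : (T.leaves c ∩ T.leaves p) \ T.leaves v ⊆ Yᶜ :=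
    (Set.sdiff_subset_sdiff_left Set.inter_subset_right).trans hP
  have heq : T.leaves v ∪ (T.leaves c \ T.leaves p) ∪ (T.leaves c ∩ T.leaves p) \ T.leaves v =
      T.leaves c := by
    ext i
    have := @leaves_mono _ _ _ _ _ _ _ _ _ hvc i
    simp only [Set.mem_union, Set.mem_sdiff, Set.mem_inter_iff]
    tauto
  have h := sameStatus_union (A := T.leaves v ∪ (T.leaves c \ T.leaves p))
    (fun h => hv (Set.subset_union_left.trans h)) hsub
  rw [heq] at h
  exact h.symm

theorem skeletonVertex_swap_iff_of_lower :
    (T.swap hvp hpq).SkeletonVertex Y w ↔ T.SkeletonVertex Y w := by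
  by_cases hw : T.tree.Lt v w ∧ T.tree.Le w p
  · exact iff_of_false (not_skeletonVertex_swap_of_le_mid hvp hpq hP hv hw.1 hw.2)
      (not_skeletonVertex_of_sdiff_subset hP hv hw.1 hw.2)
  · refine skeletonVertex_iff_of_children _ (children_swap hvp hpq w) fun c hc => ?_
    rcases not_le_lt_or_le_lt_mid_or_mid_le_lt hvp q c with h | ⟨hvc, hcp⟩ | ⟨hpc, hcq⟩
    · rw [leaves_swap_blockPerm_of_not_mem hvp hpq h]
      exact .refl _ _
    · exact absurd ⟨hvc.trans_lt (lt_of_mem_children hc), hc.2 ▸ hcp.parent_le⟩ hw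
    · rw [leaves_swap_blockPerm_of_mid_le hvp hpq hpc hcq]
      exact sameStatus_swap_of_lower hP hv (hvp.1.trans hpc)

theorem sameSkeleton_swap_of_lower : SameSkeleton T (T.swap hvp hpq) Y := by
  refine ⟨fun w => skeletonVertex_swap_iff_of_lower hvp hpq hP hv, fun u w hu hw => ?_⟩
  rw [le_swap_iff]
  rcases swap_position hvp q w with h | ⟨hvw, hwp⟩ | ⟨hpw, hwq⟩
  · rw [swapBelow_of_not_mem hvp hpq h]
    rfl
  · exact absurd hw (not_skeletonVertex_of_sdiff_subset hP hv hvw hwp)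
  · rw [swapBelow_of_mid_lt hpw hwq]
    refine ⟨?_, fun huw => ?_⟩
    · rintro (huv | huw)
      · exact huv.trans (hvp.trans hpw).1
      · exact huw.1
    · by_cases hup : T.tree.Le u p
      · exact Or.inl (hu.le_of_sdiff_subset hP hv hup)
      · exact Or.inr ⟨huw, hup⟩

end LowerBlock

section UpperBlock

variable (hQ : T.leaves q \ T.leaves p ⊆ Yᶜ) (hv : ¬ T.leaves v ⊆ Y)

include hQ hv

theorem not_skeletonVertex_swap_of_mid_lt (hpw : T.tree.Lt p w) (hwq : T.tree.Le w q) :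
    ¬ (T.swap hvp hpq).SkeletonVertex Y w := by
  refine not_skeletonVertex_of_sdiff_subset (b := v) (p := q) ?_ ?_ ⟨?_, (hvp.trans hpw).2⟩ ?_
  · rw [leaves_swap_top, leaves_swap_bot]
    rintro i ⟨hi, hiv⟩
    exact hQ (hi.resolve_left hiv)
  · rwa [leaves_swap_bot]
  · rw [le_swap_iff, swapBelow_of_mid_lt hpw hwq]
    exact Or.inl (T.tree.le_refl v)
  · rw [le_swap_iff, swapBelow_of_mid_lt hpq (T.tree.le_refl q)]
    exact Or.inr ⟨hwq, hpw.not_le⟩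

theorem skeletonVertex_swap_iff_of_upper :
    (T.swap hvp hpq).SkeletonVertex Y w ↔ T.SkeletonVertex Y w := by
  by_cases hw : T.tree.Lt p w ∧ T.tree.Le w q
  · exact iff_of_false (not_skeletonVertex_swap_of_mid_lt hvp hpq hQ hv hw.1 hw.2)
      (not_skeletonVertex_of_sdiff_subset hQ (fun h => hv ((leaves_mono hvp.1).trans h))
        hw.1 hw.2)
  · refine skeletonVertex_iff_of_children _ (children_swap hvp hpq w) fun c hc => ?_
    rcases not_le_lt_or_le_lt_mid_or_mid_le_lt hvp q c with h | ⟨hvc, hcp⟩ | ⟨hpc, hcq⟩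
    · rw [leaves_swap_blockPerm_of_not_mem hvp hpq h]
      exact .refl _ _
    · rw [leaves_swap_blockPerm_of_lt_mid hvp hpq hvc hcp]
      exact sameStatus_union (fun h => hv ((leaves_mono hvc).trans h)) hQ
    · exact absurd ⟨hpc.trans_lt (lt_of_mem_children hc), hc.2 ▸ hcq.parent_le⟩ hw

theorem sameSkeleton_swap_of_upper : SameSkeleton T (T.swap hvp hpq) Y := by
  have hp : ¬ T.leaves p ⊆ Y := fun h => hv ((leaves_mono hvp.1).trans h)
  refine ⟨fun w => skeletonVertex_swap_iff_of_upper hvp hpq hQ hv, fun u w hu hw => ?_⟩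
  rw [le_swap_iff]
  rcases swap_position hvp q w with h | ⟨hvw, hwp⟩ | ⟨hpw, hwq⟩
  · rw [swapBelow_of_not_mem hvp hpq h]
    rfl
  · rw [swapBelow_of_le_mid hvw hwp]
    refine ⟨?_, Or.inl⟩
    rintro (huw | ⟨huq, hup⟩)
    · exact huw
    · exact absurd (hu.le_of_sdiff_subset hQ hp huq) hup
  · exact absurd hw (not_skeletonVertex_of_sdiff_subset hQ hp hpw hwq)

end UpperBlock

theorem sameSkeleton_swap (hP : T.Run C v p) (hQ : T.Run Cᶜ p q) (hY : Uncrossed C Y) :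
    SameSkeleton T (T.swap hP.lt hQ.lt) Y := by
  have lower : ∀ Z : Set ι, Z ⊆ Cᶜ → SameSkeleton T (T.swap hP.lt hQ.lt) Z := fun Z hZ =>
    sameSkeleton_swap_of_lower _ _ (hP.subset.trans (Set.subset_compl_comm.1 hZ))
      fun h => hP.mixed.2 (h.trans hZ)
  have upper : ∀ Z : Set ι, Z ⊆ C → SameSkeleton T (T.swap hP.lt hQ.lt) Z := fun Z hZ =>
    sameSkeleton_swap_of_upper _ _ (hQ.subset.trans (Set.compl_subset_compl.2 hZ))
      fun h => hP.mixed.1 (h.trans hZ)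
  rcases hY with h | h | h | h
  · exact upper Y h
  · exact sameSkeleton_compl.1 (lower _ (Set.compl_subset_compl.2 h))
  · exact lower Y h
  · exact sameSkeleton_compl.1 (upper _ (Set.compl_subset_comm.1 h))

end SwapSkeleton

section SwapFactor

variable {T : RootedRankDecomposition V N} {A B C D E : Set ι} {v p q t u : N} {i : ι}

theorem isFactor_leaves (T : RootedRankDecomposition V N) (t : N) : T.IsFactor (T.leaves t) :=
  Or.inl ⟨t, rfl⟩

theorem isFactor_leaves_sdiff (T : RootedRankDecomposition V N) (t u : N) :
    T.IsFactor (T.leaves t \ T.leaves u) := by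
  by_cases h : T.IsTreeFactor (T.leaves t \ T.leaves u)
  · exact Or.inl h
  · exact Or.inr ⟨h, _, _, ⟨t, rfl⟩, ⟨u, rfl⟩, rfl⟩

theorem isFactor_iff : T.IsFactor A ↔
    (∃ t, A = T.leaves t) ∨ ∃ t u, T.tree.Le u t ∧ A = T.leaves t \ T.leaves u := by
  constructor
  · rintro (h | ⟨-, _, _, ⟨t, rfl⟩, ⟨u, rfl⟩, rfl⟩)
    · exact Or.inl h
    · by_cases hdisj : Disjoint (T.leaves t) (T.leaves u)
      · exact Or.inl ⟨t, hdisj.sdiff_eq_left⟩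
      · obtain ⟨i, hit, hiu⟩ := Set.not_disjoint_iff.1 hdisj
        rcases le_total_of_mem_leaves hit hiu with htu | hut
        · exact Or.inr ⟨t, t, T.tree.le_refl t, by
            rw [Set.sdiff_self, Set.sdiff_eq_empty.2 (leaves_mono htu)]⟩
        · exact Or.inr ⟨t, u, hut, rfl⟩
  · rintro (⟨t, rfl⟩ | ⟨t, u, -, rfl⟩)
    · exact T.isFactor_leaves t
    · exact T.isFactor_leaves_sdiff t u

theorem OneSided.subset_of_mem (h : OneSided C A) (hi : i ∈ A) (hiC : i ∈ C) : A ⊆ C :=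
  h.resolve_right fun h' => h' hi hiC

theorem OneSided.subset_compl_of_mem (h : OneSided C A) (hi : i ∈ A) (hiC : i ∉ C) : A ⊆ Cᶜ :=
  h.resolve_left fun h' => hiC (h' hi)

theorem sdiff_eq_union_sdiff_sdiff_union_sdiff (hDE : D ⊆ E) (hEB : E ⊆ B) :
    A \ B = (D ∪ (A \ E)) \ (D ∪ (B \ E)) := by
  ext i
  have := @hDE i
  have := @hEB i
  simp only [Set.mem_sdiff, Set.mem_union]
  tauto

theorem sdiff_eq_union_sdiff_union (h : Disjoint A D) : A \ B = (A ∪ D) \ (B ∪ D) := by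
  ext i
  have := fun hi : i ∈ A => Set.disjoint_left.1 h hi
  simp only [Set.mem_sdiff, Set.mem_union]
  tauto

variable [Finite N] (hP : T.MaximalRun C v p) (hQ : T.MaximalRun Cᶜ p q)
  (h : OneSided C (T.leaves t \ T.leaves u)) (hut : T.tree.Le u t)

theorem isFactor_swap_leaves (h : OneSided C (T.leaves t)) :
    (T.swap hP.lt hQ.lt).IsFactor (T.leaves t) := by
  rw [← leaves_swap_of_not_mem hP.lt hQ.lt fun ht =>
    not_mixed_iff.2 h (hP.mixed.mono ht.1.1)]
  exact isFactor_leaves _ t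

include h hut

theorem isFactor_swap_sdiff_of_not_mem (ht : ¬ (T.tree.Lt v t ∧ T.tree.Le t q)) :
    (T.swap hP.lt hQ.lt).IsFactor (T.leaves t \ T.leaves u) := by
  have ht' := leaves_swap_of_not_mem hP.lt hQ.lt ht
  by_cases hu : T.tree.Lt v u ∧ T.tree.Le u q
  · have hqt : T.tree.Lt q t := by
      refine ((hu.2.total hut).resolve_right fun htq => ht ⟨hu.1.trans_le hut, htq⟩).lt_of_ne ?_
      rintro rfl
      exact ht ⟨hu.1.trans_le hut, T.tree.le_refl _⟩
    rcases eq_or_ne u q with rfl | huq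
    · rw [← ht', ← leaves_swap_mid hP.lt hQ.lt]
      exact isFactor_leaves_sdiff _ t p
    · obtain ⟨i, hi, hiC⟩ :=
        Set.not_subset.1 (hQ.toRun.not_sdiff_subset_compl (hu.2.lt_of_ne huq))
      have hsub := h.subset_compl_of_mem
        (Set.sdiff_subset_sdiff_left (leaves_mono hqt.1) hi) fun h => hiC (not_not.2 h)
      exact absurd ((Set.sdiff_subset_sdiff_right (leaves_mono hu.2)).trans hsub)
        (hQ.top.2 t hqt)
  · rw [← ht', ← leaves_swap_of_not_mem hP.lt hQ.lt hu]
    exact isFactor_leaves_sdiff _ t u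

theorem isFactor_swap_sdiff_of_le_mid (hvt : T.tree.Lt v t) (htp : T.tree.Le t p) :
    (T.swap hP.lt hQ.lt).IsFactor (T.leaves t \ T.leaves u) := by
  have hvu : T.tree.Le v u := by
    rcases hP.mixed.le_total hvt.1 h with hvu | huv
    · exact hvu
    by_contra hnle
    have huv : T.tree.Lt u v := huv.lt_of_ne fun e => hnle (e ▸ T.tree.le_refl u)
    obtain ⟨i, hi⟩ := leaves_sdiff_nonempty hvt
    have hsub := h.subset_of_mem (Set.sdiff_subset_sdiff_right (leaves_mono huv.1) hi)
      (hP.subset (Set.sdiff_subset_sdiff_left (leaves_mono htp) hi))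
    obtain ⟨⟨c, hc⟩, -⟩ := hP.base
    refine hc.not_sdiff_subset_compl huv ?_
    rw [compl_compl]
    exact (Set.sdiff_subset_sdiff_left (leaves_mono hvt.1)).trans hsub
  have hdisj : Disjoint (T.leaves t) (T.leaves q \ T.leaves p) :=
    Set.disjoint_sdiff_right.mono_left (leaves_mono htp)
  rw [sdiff_eq_union_sdiff_union hdisj, ← leaves_swap_of_le_mid hP.lt hQ.lt hvt htp]
  rcases eq_or_ne v u with rfl | hne
  · rw [← leaves_swap_top hP.lt hQ.lt]
    exact isFactor_leaves_sdiff _ t q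
  · rw [← leaves_swap_of_le_mid hP.lt hQ.lt (hvu.lt_of_ne hne) (hut.trans htp)]
    exact isFactor_leaves_sdiff _ t u

theorem isFactor_swap_sdiff_of_mid_lt (hpt : T.tree.Lt p t) (htq : T.tree.Le t q) :
    (T.swap hP.lt hQ.lt).IsFactor (T.leaves t \ T.leaves u) := by
  have hpu : T.tree.Le p u := by
    rcases (hP.mixed.mono hP.lt.1).le_total hpt.1 h with hpu | hup
    · exact hpu
    by_contra hnle
    have hup : T.tree.Lt u p := hup.lt_of_ne fun e => hnle (e ▸ T.tree.le_refl u)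
    obtain ⟨i, hi⟩ := leaves_sdiff_nonempty hpt
    have hsub := h.subset_compl_of_mem (Set.sdiff_subset_sdiff_right (leaves_mono hup.1) hi)
      (hQ.subset (Set.sdiff_subset_sdiff_left (leaves_mono htq) hi))
    exact hP.toRun.not_sdiff_subset_compl hup <|
      (Set.sdiff_subset_sdiff_left (leaves_mono hpt.1)).trans hsub
  rw [sdiff_eq_union_sdiff_sdiff_union_sdiff (leaves_mono hP.lt.1) (leaves_mono hpu),
    ← leaves_swap_of_mid_lt hP.lt hQ.lt hpt htq]
  rcases eq_or_ne p u with rfl | hne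
  · rw [Set.sdiff_self, Set.union_empty, ← leaves_swap_bot hP.lt hQ.lt]
    exact isFactor_leaves_sdiff _ t v
  · rw [← leaves_swap_of_mid_lt hP.lt hQ.lt (hpu.lt_of_ne hne) (hut.trans htq)]
    exact isFactor_leaves_sdiff _ t u

omit h hut

theorem isFactor_swap (hA : T.IsFactor A) (hAC : OneSided C A) :
    (T.swap hP.lt hQ.lt).IsFactor A := by
  rcases isFactor_iff.1 hA with ⟨t, rfl⟩ | ⟨t, u, hut, rfl⟩
  · exact isFactor_swap_leaves hP hQ hAC
  · rcases swap_position hP.lt q t with ht | ⟨hvt, htp⟩ | ⟨hpt, htq⟩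
    · exact isFactor_swap_sdiff_of_not_mem hP hQ hAC hut ht
    · exact isFactor_swap_sdiff_of_le_mid hP hQ hAC hut hvt htp
    · exact isFactor_swap_sdiff_of_mid_lt hP hQ hAC hut hpt htq

/-- The new factor is the union of the upper block and the run below the lower one, which the
exchange makes adjacent. -/
theorem exists_new_factor_swap :
    ∃ A, (T.swap hP.lt hQ.lt).IsFactor A ∧ OneSided C A ∧ ¬ T.IsFactor A := by
  obtain ⟨⟨c, hc⟩, -⟩ := hP.base
  have hcp := hc.lt.trans hP.lt
  set A := (T.leaves v \ T.leaves c) ∪ (T.leaves q \ T.leaves p)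
  have hAC : A ⊆ Cᶜ := Set.union_subset hc.subset hQ.subset
  obtain ⟨i, hi⟩ := leaves_sdiff_nonempty hc.lt
  obtain ⟨j, hj⟩ := leaves_sdiff_nonempty hQ.lt
  have hp_le : ∀ t, A ⊆ T.leaves t → T.tree.Le p t := fun t ht =>
    (le_total_of_mem_leaves (leaves_mono hP.lt.1 hi.1) (ht (Or.inl hi))).resolve_right
      fun htp => hj.2 (leaves_mono htp (ht (Or.inr hj)))
  refine ⟨A, ?_, Or.inr hAC, fun hF => ?_⟩
  · have hAeq : A = (T.swap hP.lt hQ.lt).leaves q \ (T.swap hP.lt hQ.lt).leaves c := by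
      rw [leaves_swap_top, leaves_swap_of_not_mem _ _ fun h => h.1.not_le hc.lt.1,
        Set.union_sdiff_distrib,
        (Set.disjoint_sdiff_left.mono_right (leaves_mono hcp.1)).sdiff_eq_left]
    exact hAeq ▸ isFactor_leaves_sdiff _ q c
  · rcases isFactor_iff.1 hF with ⟨t, ht⟩ | ⟨t, u, -, ht⟩
    · exact (hP.mixed.mono hP.lt.1).2 ((leaves_mono (hp_le t ht.subset)).trans (ht ▸ hAC))
    · have hpt : T.tree.Le p t := hp_le t (ht.subset.trans Set.sdiff_subset)
      have htu : T.leaves t \ T.leaves u ⊆ Cᶜ := ht ▸ hAC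
      rcases hP.mixed.le_total (hP.lt.1.trans hpt) (Or.inr htu) with hvu | huv
      · exact (ht.subset (Or.inl hi)).2 (leaves_mono hvu hi.1)
      · exact hP.toRun.not_sdiff_subset_compl (huv.trans_lt hP.lt)
          ((Set.sdiff_subset_sdiff_left (leaves_mono hpt)).trans htu)

end SwapFactor

end RootedRankDecomposition

/-! ### Connectivity and traces -/

namespace SubspaceArrangement

variable {K E : Type*} [DivisionRing K] [AddCommGroup E] [Module K E] {ι : Type*}
  (V : ι → Submodule K E)

/-- The sum of the members of the arrangement `V` with index in `S`. -/
def span (S : Set ι) : Submodule K E := ⨆ i ∈ S, V i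

/-- The intersection of the sum over `S` with the sum over its complement. -/
def boundary (S : Set ι) : Submodule K E := span V S ⊓ span V Sᶜ

/-- The connectivity function of the arrangement `V`. -/
noncomputable def conn (S : Set ι) : ℕ := Module.finrank K (boundary V S)

/-- The trace that the members of `X` with index in `S` leave on the boundary of `X`. -/
def trace (X S : Set ι) : Submodule K E := span V (S ∩ X) ⊓ boundary V X

/-- The traces of `S` and of its complement on the boundary of `X`, condensed into a number that
is monotone in `S`. The subtraction does not truncate, since a trace lies in the boundary. -/
noncomputable def traceRank (X S : Set ι) : ℕ :=
  Module.finrank K (trace V X S) + (conn V X - Module.finrank K (trace V X Sᶜ))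

/-- `S` and its complement have the same traces on the boundary of `X` as `S'` and its
complement. -/
def SameTrace (X S S' : Set ι) : Prop :=
  trace V X S = trace V X S' ∧ trace V X Sᶜ = trace V X S'ᶜ

/-- Between `L` and `U`, the connectivity function is modular on pairs consisting of an increment
inside and an increment outside of `X`. -/
def ModularBetween (X L U : Set ι) : Prop :=
  ∀ ⦃A D G : Set ι⦄, L ⊆ A → A ∪ D ∪ G ⊆ U → D ⊆ X → G ⊆ Xᶜ →
    conn V A + conn V (A ∪ D ∪ G) = conn V (A ∪ D) + conn V (A ∪ G)

variable {V} {S S' X L U A A' B B' : Set ι}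

theorem span_mono (h : S ⊆ S') : span V S ≤ span V S' := biSup_mono h

theorem span_union : span V (S ∪ S') = span V S ⊔ span V S' := iSup_union

theorem conn_univ : conn V Set.univ = 0 := by
  have h : span V ∅ = ⊥ := by simp [span]
  rw [conn, boundary, Set.compl_univ, h, inf_bot_eq, finrank_bot]

theorem trace_mono (h : S ⊆ S') : trace V X S ≤ trace V X S' :=
  inf_le_inf_right _ (span_mono (Set.inter_subset_inter_left _ h))

theorem trace_inf_span_compl (X S : Set ι) :
    trace V X S ⊓ span V (S ∩ Xᶜ) = span V (S ∩ X) ⊓ span V (S ∩ Xᶜ) := by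
  refine le_antisymm (inf_le_inf_right _ inf_le_left) (le_inf (le_inf inf_le_left ?_) inf_le_right)
  exact inf_le_inf (span_mono Set.inter_subset_right) (span_mono Set.inter_subset_right)

theorem ModularBetween.compl (h : ModularBetween V X L U) : ModularBetween V Xᶜ L U := by
  intro A D G hA hU hD hG
  have := h (D := G) (G := D) hA (by rwa [Set.union_right_comm]) (by rwa [compl_compl] at hG) hD
  rw [Set.union_right_comm, this, add_comm]

theorem trace_congr (h : S ∩ X = S' ∩ X) : trace V X S = trace V X S' := by
  rw [trace, trace, h]

theorem compl_inter_congr {Z : Set ι} (h : A ∩ Z = B ∩ Z) : Aᶜ ∩ Z = Bᶜ ∩ Z := by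
  rw [Set.inter_comm, ← Set.sdiff_eq, ← Set.sdiff_inter_self_eq_sdiff, h,
    Set.sdiff_inter_self_eq_sdiff, Set.sdiff_eq, Set.inter_comm]

variable [FiniteDimensional K E]

theorem conn_add_finrank_span (S : Set ι) : conn V S + Module.finrank K (span V Set.univ) =
    Module.finrank K (span V S) + Module.finrank K (span V Sᶜ) := by
  rw [← Submodule.finrank_sup_add_finrank_inf_eq, ← span_union, Set.union_compl_self, add_comm]
  rfl

theorem finrank_trace_le (X S : Set ι) : Module.finrank K (trace V X S) ≤ conn V X :=
  Submodule.finrank_mono inf_le_right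

theorem traceRank_le (X S : Set ι) : traceRank V X S ≤ 2 * conn V X := by
  have := finrank_trace_le (V := V) X S
  unfold traceRank
  omega

theorem traceRank_mono (h : S ⊆ S') : traceRank V X S ≤ traceRank V X S' :=
  add_le_add (Submodule.finrank_mono (trace_mono h))
    (Nat.sub_le_sub_left (Submodule.finrank_mono (trace_mono (Set.compl_subset_compl.2 h))) _)

theorem sameTrace_of_traceRank_eq (hS : S ⊆ S') (h : traceRank V X S = traceRank V X S') :
    SameTrace V X S S' := by
  have hS' : S'ᶜ ⊆ Sᶜ := Set.compl_subset_compl.2 hS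
  have hmono : Module.finrank K (trace V X S) ≤ Module.finrank K (trace V X S') :=
    Submodule.finrank_mono (trace_mono hS)
  have hmono' : Module.finrank K (trace V X S'ᶜ) ≤ Module.finrank K (trace V X Sᶜ) :=
    Submodule.finrank_mono (trace_mono hS')
  have hle := finrank_trace_le (V := V) X Sᶜ
  unfold traceRank at h
  exact ⟨Submodule.eq_of_le_of_finrank_le (trace_mono hS) (by omega),
    (Submodule.eq_of_le_of_finrank_le (trace_mono hS') (by omega)).symm⟩

theorem finrank_span_add_finrank_inf (X S : Set ι) : Module.finrank K (span V S) +
      Module.finrank K ↥(trace V X S ⊓ span V (S ∩ Xᶜ)) =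
    Module.finrank K (span V (S ∩ X)) + Module.finrank K (span V (S ∩ Xᶜ)) := by
  have h := Submodule.finrank_sup_add_finrank_inf_eq (span V (S ∩ X)) (span V (S ∩ Xᶜ))
  rwa [← span_union, Set.inter_union_compl, ← trace_inf_span_compl] at h

theorem finrank_span_exchange (h₁ : A ∩ X = B ∩ X) (h₂ : A' ∩ X = B' ∩ X)
    (h₃ : A ∩ Xᶜ = A' ∩ Xᶜ) (h₄ : B ∩ Xᶜ = B' ∩ Xᶜ) (h : trace V X A = trace V X A') :
    Module.finrank K (span V A) + Module.finrank K (span V B') =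
      Module.finrank K (span V A') + Module.finrank K (span V B) := by
  have hA := finrank_span_add_finrank_inf (V := V) X A
  have hA' := finrank_span_add_finrank_inf (V := V) X A'
  have hB := finrank_span_add_finrank_inf (V := V) X B
  have hB' := finrank_span_add_finrank_inf (V := V) X B'
  rw [← h, ← h₃] at hA'
  rw [← trace_congr h₁, ← h₁] at hB
  rw [← trace_congr h₂, ← h, ← h₂, ← h₄] at hB'
  omega

theorem conn_exchange (h₁ : A ∩ X = B ∩ X) (h₂ : A' ∩ X = B' ∩ X) (h₃ : A ∩ Xᶜ = A' ∩ Xᶜ)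
    (h₄ : B ∩ Xᶜ = B' ∩ Xᶜ) (h : SameTrace V X A A') :
    conn V A + conn V B' = conn V A' + conn V B := by
  have hspan := finrank_span_exchange h₁ h₂ h₃ h₄ h.1
  have hspan_compl := finrank_span_exchange (compl_inter_congr h₁) (compl_inter_congr h₂)
    (compl_inter_congr h₃) (compl_inter_congr h₄) h.2
  have hA := conn_add_finrank_span (V := V) A
  have hA' := conn_add_finrank_span (V := V) A'
  have hB := conn_add_finrank_span (V := V) B
  have hB' := conn_add_finrank_span (V := V) B'
  omega

theorem modularBetween_of_traceRank_eq (h : traceRank V X L = traceRank V X U) :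
    ModularBetween V X L U := by
  intro A D G hA hU hD hG
  have hDU : A ∪ D ⊆ U := Set.subset_union_left.trans hU
  have hAD : traceRank V X A = traceRank V X (A ∪ D) :=
    (traceRank_mono Set.subset_union_left).antisymm <|
      (traceRank_mono hDU).trans (h.symm.le.trans (traceRank_mono hA))
  have hGX : G ∩ X = ∅ := (Set.subset_compl_iff_disjoint_right.1 hG).inter_eq
  have hDX : D ∩ Xᶜ = ∅ := Set.sdiff_eq D X ▸ Set.sdiff_eq_empty.2 hD
  refine conn_exchange ?_ ?_ ?_ ?_ (sameTrace_of_traceRank_eq Set.subset_union_left hAD) <;>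
    simp only [Set.union_inter_distrib_right, hGX, hDX, Set.union_empty]

end SubspaceArrangement

namespace RootedRankDecomposition

open RootedTreeOn SubspaceArrangement

variable {F : Type*} [Field F] {d : ℕ} {ι : Type*} {V : ι → Submodule F (Fin d → F)}
  {N M : Type*}

section Width

variable [Fintype N]

theorem width_le_iff {T : RootedRankDecomposition V N} {k : ℕ} :
    T.width ≤ k ↔ ∀ w, conn V (T.leaves w) ≤ k := by
  classical
  unfold width
  rw [Finset.sup_le_iff]
  refine ⟨fun h w => ?_, fun h w _ => h w⟩
  rcases eq_or_ne w T.tree.root with rfl | hw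
  · rw [leaves_root, conn_univ]
    exact Nat.zero_le k
  · exact h w (by simpa using hw)

theorem conn_leaves_le_width (T : RootedRankDecomposition V N) (w : N) :
    conn V (T.leaves w) ≤ T.width :=
  width_le_iff.1 le_rfl w

theorem width_relabel_le [Fintype M] (T : RootedRankDecomposition V N) (e : N ≃ M) :
    (T.relabel e).width ≤ T.width :=
  width_le_iff.2 <| e.surjective.forall.2 fun w =>
    (leaves_relabel T e w).symm ▸ T.conn_leaves_le_width w

theorem IsOptimum.width_le [Fintype M] {T : RootedRankDecomposition V N} (h : T.IsOptimum)
    (S : RootedRankDecomposition V M) : T.width ≤ S.width :=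
  (h _ (S.relabel (Fintype.equivFin M))).trans (S.width_relabel_le _)

theorem width_swap_le {T : RootedRankDecomposition V N} {v p q : N} {C : Set ι}
    (hP : T.Run C v p) (hQ : T.Run Cᶜ p q)
    (h : ModularBetween V C (T.leaves v) (T.leaves q))
    (hv : conn V (T.leaves v) ≤ conn V (T.leaves p))
    (hq : conn V (T.leaves q) ≤ conn V (T.leaves p)) :
    (T.swap hP.lt hQ.lt).width ≤ T.width := by
  refine width_le_iff.2 fun w => ?_
  have hw := T.conn_leaves_le_width w
  have hvp := leaves_mono hP.lt.1
  have hpq := leaves_mono hQ.lt.1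
  rcases swap_position hP.lt q w with hw' | ⟨hvw, hwp⟩ | ⟨hpw, hwq⟩
  · rwa [leaves_swap_of_not_mem hP.lt hQ.lt hw']
  · rw [leaves_swap_of_le_mid hP.lt hQ.lt hvw hwp]
    have hvw' := leaves_mono hvw.1
    have hmod := h (D := T.leaves p \ T.leaves w) (G := T.leaves q \ T.leaves p) hvw'
    rw [Set.union_sdiff_cancel (leaves_mono hwp), Set.union_sdiff_cancel hpq] at hmod
    have := hmod subset_rfl ((Set.sdiff_subset_sdiff_right hvw').trans hP.subset) hQ.subset
    omega
  · rw [leaves_swap_of_mid_lt hP.lt hQ.lt hpw hwq]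
    have hwq' := leaves_mono hwq
    have hmod := h (D := T.leaves p \ T.leaves v) (G := T.leaves w \ T.leaves p) subset_rfl
    rw [Set.union_sdiff_cancel hvp, Set.union_sdiff_cancel (leaves_mono hpw.1)] at hmod
    have := hmod hwq' hP.subset ((Set.sdiff_subset_sdiff_left hwq').trans hQ.subset)
    omega

end Width

/-! ### Dealternation -/

section Dealternation

variable {T T' T'' : RootedRankDecomposition V N} {X C : Set ι} {v p q : N}

/-- The factors of `T` that do not cross `X`. -/
def oneSidedFactors (T : RootedRankDecomposition V N) (X : Set ι) : Set (Set ι) :=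
  {A | T.IsFactor A ∧ OneSided X A}

/-- Of two consecutive maximal runs along which the trace rank is constant, one could exchange
those whose common end is at least as wide as the two outer ends. No such pair is left. -/
def Dealternated (T : RootedRankDecomposition V N) (X : Set ι) : Prop :=
  ∀ v p q, T.NextRunTop X v p → T.NextRunTop X p q →
    traceRank V X (T.leaves v) = traceRank V X (T.leaves q) →
    conn V (T.leaves p) < conn V (T.leaves v) ∨ conn V (T.leaves p) < conn V (T.leaves q)

theorem oneSidedFactors_compl : T.oneSidedFactors Xᶜ = T.oneSidedFactors X := by
  simp only [oneSidedFactors, oneSided_compl]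

theorem SameSkeleton.trans {Y : Set ι} (h : SameSkeleton T T' Y) (h' : SameSkeleton T' T'' Y) :
    SameSkeleton T T'' Y :=
  ⟨fun w => (h'.1 w).trans (h.1 w), fun u w hu hw =>
    (h'.2 u w ((h.1 u).2 hu) ((h.1 w).2 hw)).trans (h.2 u w hu hw)⟩

variable [Fintype N]

/-- `T'` is at least as good as `T`, as far as the dealternation of `X` is concerned: it is not
wider, and it retains the skeletons of the sets that do not cross `X` and the factors of `T` that
do not cross `X`. -/
structure Improves (T' T : RootedRankDecomposition V N) (X : Set ι) : Prop where
  width_le : T'.width ≤ T.width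
  sameSkeleton : ∀ Y, Uncrossed X Y → SameSkeleton T T' Y
  factors : T.oneSidedFactors X ⊆ T'.oneSidedFactors X

theorem Improves.refl (T : RootedRankDecomposition V N) (X : Set ι) : T.Improves T X :=
  ⟨le_rfl, fun _ _ => ⟨fun _ => Iff.rfl, fun _ _ _ _ => Iff.rfl⟩, subset_rfl⟩

theorem Improves.trans (h' : T''.Improves T' X) (h : T'.Improves T X) : T''.Improves T X :=
  ⟨h'.width_le.trans h.width_le, fun Y hY => (h.sameSkeleton Y hY).trans (h'.sameSkeleton Y hY),
    h.factors.trans h'.factors⟩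

theorem improves_compl : T'.Improves T Xᶜ ↔ T'.Improves T X := by
  have compl : ∀ {Z}, T'.Improves T Z → T'.Improves T Zᶜ := fun h =>
    ⟨h.width_le, fun Y hY => h.sameSkeleton Y (uncrossed_compl.1 hY), by
      rw [oneSidedFactors_compl, oneSidedFactors_compl]
      exact h.factors⟩
  exact ⟨fun h => compl_compl X ▸ compl h, compl⟩

theorem exists_improves_of_maximalRun (hP : T.MaximalRun C v p) (hQ : T.MaximalRun Cᶜ p q)
    (h : ModularBetween V C (T.leaves v) (T.leaves q))
    (hv : conn V (T.leaves v) ≤ conn V (T.leaves p))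
    (hq : conn V (T.leaves q) ≤ conn V (T.leaves p)) :
    ∃ T' : RootedRankDecomposition V N, T'.Improves T C ∧
      T.oneSidedFactors C ≠ T'.oneSidedFactors C := by
  refine ⟨T.swap hP.lt hQ.lt, ⟨width_swap_le hP.toRun hQ.toRun h hv hq,
    fun Y => sameSkeleton_swap hP.toRun hQ.toRun,
    fun A hA => ⟨isFactor_swap hP hQ hA.1 hA.2, hA.2⟩⟩, fun heq => ?_⟩
  obtain ⟨A, hA, hAC, hA'⟩ := exists_new_factor_swap hP hQ
  exact hA' (heq.superset ⟨hA, hAC⟩).1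

theorem exists_improves_of_not_dealternated (h : ¬ T.Dealternated X) :
    ∃ T' : RootedRankDecomposition V N, T'.Improves T X ∧
      T.oneSidedFactors X ≠ T'.oneSidedFactors X := by
  unfold Dealternated at h
  push Not at h
  obtain ⟨v, p, q, hP, hQ, htr, hv, hq⟩ := h
  have hmod := modularBetween_of_traceRank_eq htr
  rcases hP with hP | hP <;> rcases hQ with hQ | hQ
  · exact absurd hQ.base hP.top.not_compl
  · exact exists_improves_of_maximalRun hP hQ hmod hv hq
  · rw [← compl_compl X] at hQ
    obtain ⟨T', hT', hne⟩ := exists_improves_of_maximalRun hP hQ hmod.compl hv hq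
    rw [oneSidedFactors_compl, oneSidedFactors_compl] at hne
    exact ⟨T', improves_compl.1 hT', hne⟩
  · exact absurd hQ.base hP.top.not_compl

theorem exists_improves_dealternated (T : RootedRankDecomposition V N) (X : Set ι) :
    ∃ T' : RootedRankDecomposition V N, T'.Improves T X ∧ T'.Dealternated X := by
  have : Finite ι := Finite.of_equiv _ T.leaf.symm
  induction hS : T.oneSidedFactors X using (wellFounded_gt (α := Set (Set ι))).induction
    generalizing T with
  | _ S ih =>
    by_cases h : T.Dealternated X
    · exact ⟨T, .refl T X, h⟩
    · obtain ⟨T₁, h₁, hne⟩ := exists_improves_of_not_dealternated h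
      obtain ⟨T₂, h₂, hd⟩ := ih _ (hS ▸ h₁.factors.ssubset_of_ne hne) T₁ rfl
      exact ⟨T₂, h₂.trans h₁, hd⟩

end Dealternation

/-! ### The number of run tops -/

section Counting

variable {T : RootedRankDecomposition V N} {r r' r₁ : N} {X : Set ι} {k : ℕ}

/-- The next run top has the same trace rank and no larger connectivity. -/
def Descends (T : RootedRankDecomposition V N) (X : Set ι) (r : N) : Prop :=
  ∃ r', T.NextRunTop X r r' ∧ traceRank V X (T.leaves r) = traceRank V X (T.leaves r') ∧
    conn V (T.leaves r') ≤ conn V (T.leaves r)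

theorem Dealternated.descends (hT : T.Dealternated X) (h : T.NextRunTop X r r')
    (htr : traceRank V X (T.leaves r) = traceRank V X (T.leaves r')) (hd : T.Descends X r') :
    conn V (T.leaves r') < conn V (T.leaves r) ∧ T.Descends X r := by
  obtain ⟨r₂, h₂, htr₂, hc⟩ := hd
  have hlt := (hT r r' r₂ h h₂ (htr.trans htr₂)).resolve_right hc.not_gt
  exact ⟨hlt, r', h, htr, hlt.le⟩

theorem traceRank_eq_of_between (h : T.tree.Le r r₁) (h' : T.tree.Le r₁ r')
    (htr : traceRank V X (T.leaves r) = traceRank V X (T.leaves r')) :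
    traceRank V X (T.leaves r) = traceRank V X (T.leaves r₁) ∧
      traceRank V X (T.leaves r₁) = traceRank V X (T.leaves r') := by
  have hle := traceRank_mono (V := V) (X := X) (leaves_mono h)
  have hle' := traceRank_mono (V := V) (X := X) (leaves_mono h')
  omega

theorem Dealternated.conn_lt_of_descends (hT : T.Dealternated X)
    (h : Relation.TransGen (T.NextRunTop X) r r')
    (htr : traceRank V X (T.leaves r) = traceRank V X (T.leaves r')) (hd : T.Descends X r') :
    conn V (T.leaves r') < conn V (T.leaves r) ∧ T.Descends X r := by
  induction h using Relation.TransGen.head_induction_on with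
  | single h => exact hT.descends h htr hd
  | head h h' ih =>
    obtain ⟨htr₁, htr₁'⟩ :=
      traceRank_eq_of_between h.lt.1 (lt_of_transGen_nextRunTop h').1 htr
    obtain ⟨hlt₁, hd₁⟩ := ih htr₁'
    obtain ⟨hlt, hd⟩ := hT.descends h htr₁ hd₁
    exact ⟨hlt₁.trans hlt, hd⟩

theorem Dealternated.conn_lt_of_not_descends (hT : T.Dealternated X)
    (h : Relation.TransGen (T.NextRunTop X) r r')
    (htr : traceRank V X (T.leaves r) = traceRank V X (T.leaves r')) (hd : ¬ T.Descends X r) :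
    conn V (T.leaves r) < conn V (T.leaves r') := by
  induction h using Relation.TransGen.head_induction_on with
  | single h => exact lt_of_not_ge fun hle => hd ⟨_, h, htr, hle⟩
  | head h h' ih =>
    obtain ⟨htr₁, htr₁'⟩ :=
      traceRank_eq_of_between h.lt.1 (lt_of_transGen_nextRunTop h').1 htr
    have hlt := lt_of_not_ge fun hle => hd ⟨_, h, htr₁, hle⟩
    exact hlt.trans (ih htr₁' fun hd₁ => hd (hT.descends h htr₁ hd₁).2)

/-- Along a chain of run tops with constant trace rank, the connectivity strictly decreases as long
as `Descends` holds, and strictly increases from then on. -/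
theorem Dealternated.not_transGen_of_eq (hT : T.Dealternated X)
    (htr : traceRank V X (T.leaves r) = traceRank V X (T.leaves r'))
    (hconn : conn V (T.leaves r) = conn V (T.leaves r'))
    (hd : T.Descends X r ↔ T.Descends X r') : ¬ Relation.TransGen (T.NextRunTop X) r r' := by
  intro h
  by_cases hr' : T.Descends X r'
  · exact (hT.conn_lt_of_descends h htr hr').1.ne' hconn
  · exact (hT.conn_lt_of_not_descends h htr fun hr => hr' (hd.1 hr)).ne hconn

variable [Finite N]

theorem Dealternated.runTop_eq_of_eq (hT : T.Dealternated X) {s : N}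
    (hr : T.RunTop X r) (hr' : T.RunTop X r')
    (hsr : T.tree.Le s r ∧ ∀ u, T.SkeletonVertex X u → T.tree.Le u r → T.tree.Le u s)
    (hsr' : T.tree.Le s r' ∧ ∀ u, T.SkeletonVertex X u → T.tree.Le u r' → T.tree.Le u s)
    (htr : traceRank V X (T.leaves r) = traceRank V X (T.leaves r'))
    (hconn : conn V (T.leaves r) = conn V (T.leaves r'))
    (hd : T.Descends X r ↔ T.Descends X r') : r = r' := by
  by_contra hne
  rcases hsr.1.total hsr'.1 with hle | hle
  · exact hT.not_transGen_of_eq htr hconn hd <|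
      transGen_nextRunTop (.inl hr) (.inl hr') (hle.lt_of_ne hne) fun w hw hwr' hv =>
        hw.not_le ((hsr'.2 w hv hwr').trans hsr.1)
  · exact hT.not_transGen_of_eq htr.symm hconn.symm hd.symm <|
      transGen_nextRunTop (.inl hr') (.inl hr) (hle.lt_of_ne (Ne.symm hne)) fun w hw hwr hv =>
        hw.not_le ((hsr.2 w hv hwr).trans hsr'.1)

theorem Dealternated.ncard_runTop_le (hT : T.Dealternated X)
    (hk : ∀ w, conn V (T.leaves w) ≤ k) (hX : conn V X ≤ k) :
    {r | T.RunTop X r}.ncard ≤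
      {s | T.SkeletonVertex X s}.ncard * ((2 * k + 1) * ((k + 1) * 2)) := by
  have : Nonempty N := ⟨T.tree.root⟩
  choose! s hs using fun r (hr : T.RunTop X r) => hr.mixed.exists_highest_vertex
  let code (r : N) : N × ℕ × ℕ × Prop :=
    (s r, traceRank V X (T.leaves r), conn V (T.leaves r), T.Descends X r)
  let codes : Set (N × ℕ × ℕ × Prop) :=
    {s | T.SkeletonVertex X s} ×ˢ (Set.Iio (2 * k + 1) ×ˢ (Set.Iio (k + 1) ×ˢ Set.univ))
  have hmaps : ∀ r ∈ {r | T.RunTop X r}, code r ∈ codes := fun r hr =>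
    ⟨(hs r hr).1, Nat.lt_succ_of_le ((traceRank_le X _).trans (Nat.mul_le_mul_left 2 hX)),
      Nat.lt_succ_of_le (hk r), trivial⟩
  have hinj : Set.InjOn code {r | T.RunTop X r} := fun r hr r' hr' heq => by
    simp only [code, Prod.mk.injEq, eq_iff_iff] at heq
    exact hT.runTop_eq_of_eq hr hr' (hs r hr).2 (heq.1 ▸ (hs r' hr').2) heq.2.1 heq.2.2.1 heq.2.2.2
  refine (Set.ncard_le_ncard_of_injOn code hmaps hinj ?_).trans_eq ?_
  · exact (Set.toFinite _).prod ((Set.finite_Iio _).prod ((Set.finite_Iio _).prod Set.finite_univ))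
  · have hIio (n : ℕ) : (Set.Iio n).ncard = n := by
      rw [← Finset.coe_Iio, Set.ncard_coe_finset, Nat.card_Iio]
    simp only [codes, Set.ncard_prod, hIio, Set.ncard_univ, Nat.card_eq_fintype_card,
      Fintype.card_prop]

end Counting

/-! ### The partition into blocks -/

section Blocks

variable {T : RootedRankDecomposition V N} {X : Set ι} {r r' b b' c w : N} {i : ι}

/-- `X` separates the children of `w`, and `b` is the one with all its leaves in `X`. -/
def SplitsAt (T : RootedRankDecomposition V N) (X : Set ι) (w b : N) : Prop :=
  ∃ a, a ≠ b ∧ T.tree.children w = {a, b} ∧ T.leaves a ⊆ Xᶜ ∧ T.leaves b ⊆ X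

/-- The block of members of `X` that is assigned to the node `r`: the members hanging off the
maximal run of `X` with upper end `r`, and those below the full child of `r` if `X` separates the
children of `r`. -/
def block (T : RootedRankDecomposition V N) (X : Set ι) (r : N) : Set ι :=
  {i | (T.RunTop X r ∧ ∃ c, T.Run X c r ∧ i ∈ T.leaves r \ T.leaves c) ∨
    ∃ b, T.SplitsAt X r b ∧ i ∈ T.leaves b}

theorem SplitsAt.mem_children (h : T.SplitsAt X w b) : b ∈ T.tree.children w :=
  have ⟨a, _, hw, _⟩ := h
  hw ▸ Set.mem_insert_of_mem a rfl

theorem SplitsAt.skeletonVertex (h : T.SplitsAt X w b) : T.SkeletonVertex X w :=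
  have ⟨a, hab, hw, ha, hb⟩ := h
  ⟨a, hw ▸ Set.mem_insert a {b}, b, h.mem_children, hab, Or.inl ⟨ha, hb⟩⟩

theorem SplitsAt.not_mixed (h : T.SplitsAt X w b) (hcw : T.tree.Lt c w) : ¬ T.Mixed X c := by
  obtain ⟨a, -, hw, ha, hb⟩ := h
  obtain ⟨e, he, hce⟩ := exists_child_of_lt hcw
  rw [hw] at he
  rcases he with rfl | rfl
  · exact fun hc => hc.2 ((leaves_mono hce).trans ha)
  · exact fun hc => hc.1 ((leaves_mono hce).trans hb)

theorem block_subset (T : RootedRankDecomposition V N) (X : Set ι) (r : N) : T.block X r ⊆ X := by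
  rintro i (⟨-, c, hc, hi⟩ | ⟨b, ⟨a, -, -, -, hb⟩, hi⟩)
  · exact hc.subset hi
  · exact hb hi

theorem block_subset_leaves (T : RootedRankDecomposition V N) (X : Set ι) (r : N) :
    T.block X r ⊆ T.leaves r := by
  rintro i (⟨-, c, -, hi⟩ | ⟨b, hb, hi⟩)
  · exact hi.1
  · exact leaves_mono (lt_of_mem_children hb.mem_children).1 hi

theorem runTop_or_skeletonVertex_of_mem_block (h : i ∈ T.block X r) :
    T.RunTop X r ∨ T.SkeletonVertex X r :=
  h.imp (fun h => h.1) fun ⟨_, hb, _⟩ => hb.skeletonVertex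

variable [Finite N]

theorem SplitsAt.unique (h : T.SplitsAt X w b) (h' : T.SplitsAt X w b') : b' = b := by
  obtain ⟨a, -, hw, ha, -⟩ := h
  have hb' := h'.mem_children
  obtain ⟨-, -, -, -, hb'X⟩ := h'
  rw [hw] at hb'
  refine hb'.resolve_left ?_
  rintro rfl
  obtain ⟨i, hi⟩ := T.leaves_nonempty b'
  exact ha hi (hb'X hi)

theorem mixed_of_mem_block (h : i ∈ T.block X r) : T.Mixed X r :=
  (runTop_or_skeletonVertex_of_mem_block h).elim RunTop.mixed SkeletonVertex.mixed

theorem not_lt_of_mem_block (h : i ∈ T.block X r) (h' : i ∈ T.block X r') :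
    ¬ T.tree.Lt r r' := by
  intro hlt
  have hir := T.block_subset_leaves X r h
  rcases h' with ⟨-, c, hc, hi⟩ | ⟨b, hb, -⟩
  · have hcr : T.tree.Le c r := ((mixed_of_mem_block h).le_total hlt.1
      (Or.inl hc.subset)).resolve_left fun hrc => hi.2 (leaves_mono hrc hir)
    rcases h with ⟨hr, -⟩ | ⟨b, hb, -⟩
    · exact hr.2 r' hlt ((Set.sdiff_subset_sdiff_right (leaves_mono hcr)).trans hc.subset)
    · exact hb.not_mixed (hcr.lt_of_ne fun e => hi.2 (e ▸ hir)) hc.mixed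
  · exact hb.not_mixed hlt (mixed_of_mem_block h)

theorem eq_of_mem_block (h : i ∈ T.block X r) (h' : i ∈ T.block X r') : r = r' := by
  by_contra hne
  rcases le_total_of_mem_leaves (T.block_subset_leaves X r h) (T.block_subset_leaves X r' h')
    with hle | hle
  · exact not_lt_of_mem_block h h' ⟨hle, hne⟩
  · exact not_lt_of_mem_block h' h ⟨hle, Ne.symm hne⟩

theorem exists_mem_block (hroot : T.Mixed X T.tree.root) (hi : i ∈ X) :
    ∃ r, i ∈ T.block X r := by
  obtain ⟨w, ⟨hw, hiw⟩, hlow⟩ := T.tree.exists_lowest (S := {w | T.Mixed X w ∧ i ∈ T.leaves w})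
    ⟨_, hroot, T.leaves_root ▸ Set.mem_univ i⟩
  obtain ⟨a, b, hab, hchildren⟩ := exists_children_eq_pair hw.not_isLeaf
  have hunion := leaves_eq_union hchildren
  wlog hia : i ∈ T.leaves a generalizing a b
  · rw [Set.pair_comm] at hchildren
    exact this b a hab.symm hchildren (leaves_eq_union hchildren)
      ((hunion ▸ hiw).resolve_left hia)
  have ha : a ∈ T.tree.children w := hchildren ▸ Set.mem_insert a {b}
  have hb : b ∈ T.tree.children w := hchildren ▸ Set.mem_insert_of_mem a rfl
  have haX : T.leaves a ⊆ X := (not_mixed_iff.1 fun hmixed =>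
    hlow a ⟨hmixed, hia⟩ (lt_of_mem_children ha)).subset_of_mem hia hi
  by_cases hbm : T.Mixed X b
  · have hib : i ∉ T.leaves b := Set.disjoint_left.1 (disjoint_leaves_of_mem_children ha hb hab) hia
    have hsub : T.leaves w \ T.leaves b ⊆ X := fun j hj => haX ((hunion ▸ hj.1).resolve_right hj.2)
    obtain ⟨r, hwr, hrb, htop⟩ := exists_highest_extension hsub
    have hrun : T.Run X b r := ⟨(lt_of_mem_children hb).trans_le hwr, hbm, hrb⟩
    exact ⟨r, Or.inl ⟨⟨⟨b, hrun⟩, htop⟩, b, hrun, leaves_mono hwr hiw, hib⟩⟩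
  · have hbX : T.leaves b ⊆ Xᶜ := (not_mixed_iff.1 hbm).resolve_left fun hbX =>
      hw.1 (hunion ▸ Set.union_subset haX hbX)
    exact ⟨w, Or.inr ⟨a, ⟨b, hab.symm, hchildren.trans (Set.pair_comm a b), hbX, haX⟩, hia⟩⟩

theorem isFactor_block_of_runTop (hr : T.RunTop X r) : T.IsFactor (T.block X r) := by
  obtain ⟨c, hc, hlow⟩ := T.tree.exists_lowest (S := {c | T.Run X c r}) hr.1
  convert T.isFactor_leaves_sdiff r c using 1
  refine Set.Subset.antisymm ?_ fun i hi => Or.inl ⟨hr, c, hc, hi⟩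
  rintro i (⟨-, c', hc', hi⟩ | ⟨b, hb, -⟩)
  · have hle : T.tree.Le c c' := by
      rcases hc'.mixed.le_total hc'.lt.1 (Or.inl hc.subset) with hle | hle
      · exact (not_imp_comm.1 hle.lt_of_ne (hlow c' hc')) ▸ T.tree.le_refl c'
      · exact hle
    exact ⟨hi.1, fun hic => hi.2 (leaves_mono hle hic)⟩
  · exact absurd hc.mixed (hb.not_mixed hc.lt)

theorem isFactor_block_of_not_runTop (hr : ¬ T.RunTop X r) : T.IsFactor (T.block X r) := by
  have hblock : ∀ i, i ∈ T.block X r ↔ ∃ b, T.SplitsAt X r b ∧ i ∈ T.leaves b :=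
    fun i => or_iff_right fun h => hr h.1
  by_cases hb : ∃ b, T.SplitsAt X r b
  · obtain ⟨b, hb⟩ := hb
    convert T.isFactor_leaves b using 1
    ext i
    exact (hblock i).trans
      ⟨fun ⟨_, hb', hi⟩ => hb.unique hb' ▸ hi, fun hi => ⟨b, hb, hi⟩⟩
  · have hempty : T.block X r = T.leaves r \ T.leaves r := by
      ext i
      simp only [hblock, not_exists.1 hb, Set.sdiff_self, false_and, exists_false,
        Set.mem_empty_iff_false]
    exact hempty ▸ T.isFactor_leaves_sdiff r r

theorem isFactor_block (T : RootedRankDecomposition V N) (X : Set ι) (r : N) :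
    T.IsFactor (T.block X r) :=
  (em (T.RunTop X r)).elim isFactor_block_of_runTop isFactor_block_of_not_runTop

theorem exists_factor_partition (T : RootedRankDecomposition V N) (X : Set ι) :
    ∃ 𝓕 : Finset (Set ι),
      𝓕.card ≤ {r | T.RunTop X r}.ncard + {s | T.SkeletonVertex X s}.ncard + 1 ∧
      (∀ A ∈ 𝓕, T.IsFactor A ∧ A ⊆ X) ∧ (𝓕 : Set (Set ι)).PairwiseDisjoint id ∧
      ⋃₀ (𝓕 : Set (Set ι)) = X := by
  by_cases hroot : T.Mixed X T.tree.root
  · let R : Set N := {r | T.RunTop X r} ∪ {s | T.SkeletonVertex X s}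
    refine ⟨(Set.toFinite (T.block X '' R)).toFinset, ?_, ?_, ?_, ?_⟩
    · rw [← Set.ncard_eq_toFinset_card (T.block X '' R)]
      exact (Set.ncard_image_le (Set.toFinite R)).trans
        ((Set.ncard_union_le _ _).trans (Nat.le_succ _))
    · simp only [Set.Finite.mem_toFinset, Set.forall_mem_image]
      exact fun r _ => ⟨T.isFactor_block X r, T.block_subset X r⟩
    · rw [Set.Finite.coe_toFinset]
      rintro _ ⟨r, -, rfl⟩ _ ⟨r', -, rfl⟩ hne
      exact Set.disjoint_left.2 fun i hi hi' => hne (congrArg _ (eq_of_mem_block hi hi'))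
    · rw [Set.Finite.coe_toFinset, Set.sUnion_image]
      refine Set.Subset.antisymm (Set.iUnion₂_subset fun r _ => T.block_subset X r) fun i hi => ?_
      obtain ⟨r, hr⟩ := exists_mem_block hroot hi
      exact Set.mem_biUnion (runTop_or_skeletonVertex_of_mem_block hr) hr
  · rw [not_mixed_iff, leaves_root] at hroot
    rcases hroot with hX | hX
    · obtain rfl := Set.univ_subset_iff.1 hX
      exact ⟨{Set.univ}, by simp, by simpa using T.leaves_root ▸ T.isFactor_leaves T.tree.root,
        by simp, by simp⟩
    · obtain rfl := Set.compl_univ_iff.1 (Set.univ_subset_iff.1 hX)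
      exact ⟨∅, by simp, by simp, by simp, by simp⟩

end Blocks

theorem oneSided_leaves_of_not_lt {T : RootedRankDecomposition V M} {x y : M}
    (hxy : ¬ T.tree.Lt x y) : OneSided (T.leaves x) (T.leaves y) := by
  by_cases hdisj : Disjoint (T.leaves y) (T.leaves x)
  · exact Or.inr (Set.subset_compl_iff_disjoint_right.2 hdisj)
  · obtain ⟨i, hiy, hix⟩ := Set.not_disjoint_iff.1 hdisj
    refine Or.inl (leaves_mono ((le_total_of_mem_leaves hiy hix).elim id fun hle => ?_))
    exact (not_imp_comm.1 hle.lt_of_ne hxy) ▸ T.tree.le_refl x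

theorem uncrossed_leaves (T : RootedRankDecomposition V M) (x y : M) :
    Uncrossed (T.leaves x) (T.leaves y) := by
  by_cases hxy : T.tree.Lt x y
  · exact Or.inr (Or.inl (leaves_mono hxy.1))
  · exact (oneSided_leaves_of_not_lt hxy).imp_right fun h => Or.inr (Or.inl h)

theorem SameSkeleton.mixedSkeleton_eq [Finite N] {Tb : RootedRankDecomposition V M}
    {T T' : RootedRankDecomposition V N} {y : M} (h : SameSkeleton T T' (Tb.leaves y)) :
    Tb.mixedSkeleton y T' = Tb.mixedSkeleton y T :=
  RootedRankDecomposition.mixedSkeleton_eq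
    (Set.ext fun w => mem_skeletonVerts_iff.trans ((h.1 w).trans mem_skeletonVerts_iff.symm))
    fun u hu w hw => h.2 u w (mem_skeletonVerts_iff.1 hu) (mem_skeletonVerts_iff.1 hw)

end RootedRankDecomposition

open RootedRankDecomposition SubspaceArrangement in
theorem lemma8p10_general (g : ℕ → ℕ) :
    ∃ f : ℕ → ℕ,
      ∀ (F : Type*) [Field F] (d : ℕ) (ι : Type*) (V : ι → Submodule F (Fin d → F))
        (M : Type*) (N : Type*) [Fintype N]
        (ℓ : ℕ) (Tb : RootedRankDecomposition V M) (T : RootedRankDecomposition V N) (x : M),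
        Module.finrank F (Tb.boundary x) ≤ ℓ →
        T.width ≤ ℓ →
        (Tb.mixedSkeleton x T).verts.ncard ≤ g ℓ →
        ∃ T' : RootedRankDecomposition V N,
          T'.width ≤ T.width ∧
          (∃ 𝓕 : Finset (Set ι), 𝓕.card ≤ f ℓ ∧
            (∀ A ∈ 𝓕, Tb.IsNodeFactor x T' A) ∧
            (𝓕 : Set (Set ι)).PairwiseDisjoint id ∧
            ⋃₀ (𝓕 : Set (Set ι)) = Tb.leaves x) ∧
          (∀ y : M, Tb.mixedSkeleton y T' = Tb.mixedSkeleton y T) ∧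
          (∀ y : M, ¬ Tb.tree.Lt x y →
            ∀ A : Set ι, Tb.IsNodeFactor y T A → Tb.IsNodeFactor y T' A) := by
  refine ⟨fun ℓ => g ℓ * ((2 * ℓ + 1) * ((ℓ + 1) * 2)) + g ℓ + 1, ?_⟩
  intro F _ d ι V M N _ ℓ Tb T x hx hT hg
  obtain ⟨T', himp, hdealt⟩ := T.exists_improves_dealternated (Tb.leaves x)
  have hskel (y : M) : Tb.mixedSkeleton y T' = Tb.mixedSkeleton y T :=
    (himp.sameSkeleton _ (Tb.uncrossed_leaves x y)).mixedSkeleton_eq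
  refine ⟨T', himp.width_le, ?_, hskel, fun y hy A hA => ⟨(himp.factors ⟨hA.1, ?_⟩).1, hA.2⟩⟩
  · obtain ⟨𝓕, hcard, hfactor, hdisj, hunion⟩ := T'.exists_factor_partition (Tb.leaves x)
    refine ⟨𝓕, hcard.trans ?_, hfactor, hdisj, hunion⟩
    have hverts : {s | T'.SkeletonVertex (Tb.leaves x) s}.ncard ≤ g ℓ := by
      rw [← skeletonVerts_eq_setOf]
      exact (congrArg (fun S => S.verts.ncard) (hskel x)).trans_le hg
    have hruns := hdealt.ncard_runTop_le
      (fun w => (T'.conn_leaves_le_width w).trans (himp.width_le.trans hT)) hx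
    exact Nat.succ_le_succ (Nat.add_le_add (hruns.trans (Nat.mul_le_mul_right _ hverts)) hverts)
  · exact (oneSided_leaves_of_not_lt hy).mono hA.2

theorem lemma8p10 (F : Type*) [Field F] [Finite F] (g : ℕ → ℕ) :
    ∃ f : ℕ → ℕ,
      ∀ (d : ℕ) (ι : Type*) [Finite ι] (V : ι → Submodule F (Fin d → F))
        (M : Type*) [Fintype M] (N : Type*) [Fintype N]
        (ℓ : ℕ) (Tb : RootedRankDecomposition V M) (T : RootedRankDecomposition V N) (x : M),
        Tb.width = ℓ →
        T.IsOptimum →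
        (Tb.mixedSkeleton x T).verts.ncard ≤ g ℓ →
        ∃ T' : RootedRankDecomposition V N,
          T'.IsOptimum ∧
          (∃ 𝓕 : Finset (Set ι), 𝓕.card ≤ f ℓ ∧
            (∀ A ∈ 𝓕, Tb.IsNodeFactor x T' A) ∧
            (𝓕 : Set (Set ι)).PairwiseDisjoint id ∧
            ⋃₀ (𝓕 : Set (Set ι)) = Tb.leaves x) ∧
          (∀ y : M, Tb.mixedSkeleton y T' = Tb.mixedSkeleton y T) ∧
          (∀ y : M, ¬ Tb.tree.Lt x y →
            ∀ A : Set ι, Tb.IsNodeFactor y T A → Tb.IsNodeFactor y T' A) := by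
  obtain ⟨f, hf⟩ := lemma8p10_general g
  refine ⟨f, fun d ι _ V M _ N _ ℓ Tb T x hℓ hopt hg => ?_⟩
  obtain ⟨T', hw, hT'⟩ := hf F d ι V M N ℓ Tb T x (hℓ ▸ Tb.conn_leaves_le_width x)
    (hℓ ▸ hopt.width_le Tb) hg
  exact ⟨T', fun m S => hw.trans (hopt m S), hT'⟩
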